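/- Let $0<\mu<1$ and let $L^2(e^{\mu x})$ be the real Hilbert space of (classes of) functions $h$ on $(0,\infty)$ with norm $\|h\|_{L^2(e^{\mu x})}=\bigl(\int_0^\infty |h(x)|^2e^{\mu x}\,dx\bigr)^{1/2}<\infty$. For $h\in C_c^\infty(0,\infty)$ put $$\mathcal L_0[h](x)=x\,h'(x)-2H(x)+2\int_0^x H(y)\,e^{-(x-y)}\,dy,\qquad H(x)=\int_x^\infty h(z)\,dz .$$ **Proposition.** $\mathcal L_0$ generates a strongly continuous semigroup $(e^{\mathcal L_0t})_{t\ge 0}$ on $L^2(e^{\mu x})$; that is, $\mathcal L_0$, as an unbounded operator on $L^2(e^{\mu x})$ with domain $C_c^\infty(0,\infty)$, is closable and its closure is the infinitesimal generator of a strongly continuous semigroup. Moreover, for each $\lambda\in(-\infty,1/2]$ there exists $C_\lambda>0$ such that $$\|e^{\mathcal L_0t}h_0\|_{L^2(e^{\mu x})}\le C_\lambda\,e^{-\lambda t}\,\|h_0\|_{L^2(e^{\mu x})}$$ for all $t\ge 0$ and all $h_0\in L^2(e^{\mu x})$ with $\int_0^\infty x\,h_0(x)\,dx=0$. -/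

import Mathlib

open Set MeasureTheory Filter Topology Distributions
open scoped NNReal ENNReal

/-! ### Strongly continuous semigroups and their generators -/

/-- A strongly continuous one-parameter semigroup `(T t)`, `t ≥ 0`, of bounded linear operators on
a real normed space `E`. -/
structure C0Semigroup (E : Type*) [NormedAddCommGroup E] [NormedSpace ℝ E] where
  /-- the operator at time `t` -/
  op : ℝ≥0 → E →L[ℝ] E
  op_zero : op 0 = ContinuousLinearMap.id ℝ E
  op_add : ∀ s t : ℝ≥0, op (s + t) = (op s).comp (op t)
  continuous_orbit : ∀ x : E, Continuous fun t => op t x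

namespace C0Semigroup

variable {E : Type*} [NormedAddCommGroup E] [NormedSpace ℝ E]

/-- `y` is the derivative at `t = 0⁺` of the orbit of `x`:
`(T t x - x) / t → y` in norm as `t ↓ 0`. -/
def HasGen (T : C0Semigroup E) (x y : E) : Prop :=
  Tendsto (fun t : ℝ≥0 => (t : ℝ)⁻¹ • (T.op t x - x)) (𝓝[>] 0) (𝓝 y)

theorem HasGen.add {T : C0Semigroup E} {x x' y y' : E} (h : T.HasGen x y) (h' : T.HasGen x' y') :
    T.HasGen (x + x') (y + y') := by
  refine (Tendsto.add h h').congr fun t => ?_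
  rw [← smul_add, map_add]
  congr 1
  abel

theorem HasGen.smul {T : C0Semigroup E} {x y : E} (c : ℝ) (h : T.HasGen x y) :
    T.HasGen (c • x) (c • y) := by
  refine (Tendsto.const_smul h c).congr fun t => ?_
  rw [smul_comm, map_smul, smul_sub]

theorem HasGen.zero (T : C0Semigroup E) : T.HasGen 0 0 := by
  simp [HasGen]

theorem HasGen.unique {T : C0Semigroup E} {x y y' : E} (h : T.HasGen x y) (h' : T.HasGen x y') :
    y = y' :=
  tendsto_nhds_unique h h'

/-- The infinitesimal generator: the unbounded operator `A x = lim_{t ↓ 0} (T t x - x) / t` whose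
domain consists of all `x` for which this limit exists in norm. -/
noncomputable def generator (T : C0Semigroup E) : E →ₗ.[ℝ] E where
  domain :=
    { carrier := {x | ∃ y, T.HasGen x y}
      add_mem' := fun ⟨_, h⟩ ⟨_, h'⟩ => ⟨_, h.add h'⟩
      zero_mem' := ⟨0, HasGen.zero T⟩
      smul_mem' := fun c _ ⟨_, h⟩ => ⟨_, h.smul c⟩ }
  toFun :=
    { toFun := fun x => x.2.choose
      map_add' := fun x x' =>
        (x + x').2.choose_spec.unique (x.2.choose_spec.add x'.2.choose_spec)
      map_smul' := fun c x => (c • x).2.choose_spec.unique (x.2.choose_spec.smul c) }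

theorem mem_generator_graph_iff (T : C0Semigroup E) (x y : E) :
    (x, y) ∈ T.generator.graph ↔ T.HasGen x y := by
  rw [LinearPMap.mem_graph_iff]
  constructor
  · rintro ⟨z, hz, hy⟩
    simp only at hz hy
    subst hz hy
    exact z.2.choose_spec
  · intro h
    exact ⟨⟨x, y, h⟩, rfl, (Exists.choose_spec (p := fun y => T.HasGen x y) ⟨y, h⟩).unique h⟩

end C0Semigroup

/-- The densely defined operator `L`, understood through its closure, generates the semigroup `T`:
`L` is closable and its closure is the infinitesimal generator of `T`. -/
def Generates {E : Type*} [NormedAddCommGroup E] [NormedSpace ℝ E]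
    (L : E →ₗ.[ℝ] E) (T : C0Semigroup E) : Prop :=
  L.IsClosable ∧ L.closure = T.generator

/-! ### The weighted space `L²(e^{μx})` on the half line -/

/-- The measure `e^{μx} dx` on `(0, ∞)`. -/
noncomputable def expMeasure (μ : ℝ) : Measure ℝ :=
  (volume.restrict (Ioi 0)).withDensity fun x => ENNReal.ofReal (Real.exp (μ * x))

/-- The real Hilbert space `L²(e^{μx})` of functions on `(0, ∞)`, with norm
`‖h‖² = ∫₀^∞ |h(x)|² e^{μx} dx`. -/
abbrev L2Exp (μ : ℝ) : Type := Lp ℝ 2 (expMeasure μ)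

/-- The open half line `(0, ∞)`. -/
def halfLine : TopologicalSpace.Opens ℝ := ⟨Ioi 0, isOpen_Ioi⟩

/-! ### The linearised operator on `C_c^∞(0, ∞)` -/

/-- The primitive `H(x) = ∫_x^∞ h(z) dz`. -/
noncomputable def tailPrimitive (h : ℝ → ℝ) (x : ℝ) : ℝ := ∫ z in Ioi x, h z

/-- `L₀[h](x) = x h'(x) - 2 H(x) + 2 ∫_0^x H(y) e^{-(x-y)} dy` with `H(x) = ∫_x^∞ h(z) dz`. -/
noncomputable def linCoag (h : ℝ → ℝ) (x : ℝ) : ℝ :=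
  x * deriv h x - 2 * tailPrimitive h x
    + 2 * ∫ y in (0 : ℝ)..x, tailPrimitive h y * Real.exp (-(x - y))

section MemLp

theorem tailPrimitive_eq (φ : 𝓓(halfLine, ℝ)) (x : ℝ) :
    tailPrimitive φ x = (∫ z in Ioi 0, φ z) - ∫ z in (0 : ℝ)..x, φ z := by
  have hi : Integrable φ := φ.continuous.integrable_of_hasCompactSupport φ.hasCompactSupport
  have := intervalIntegral.integral_interval_add_Ioi (f := φ) (μ := volume) (a := 0) (b := x)
    hi.integrableOn hi.integrableOn
  rw [tailPrimitive]
  linarith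

theorem continuous_tailPrimitive (φ : 𝓓(halfLine, ℝ)) : Continuous (tailPrimitive φ) := by
  have h : tailPrimitive φ = fun x => (∫ z in Ioi 0, φ z) - ∫ z in (0 : ℝ)..x, φ z :=
    funext (tailPrimitive_eq φ)
  rw [h]
  exact continuous_const.sub
    (intervalIntegral.continuous_primitive (fun a b => φ.continuous.intervalIntegrable a b) 0)

theorem tailPrimitive_add (φ ψ : 𝓓(halfLine, ℝ)) (x : ℝ) :
    tailPrimitive (φ + ψ : 𝓓(halfLine, ℝ)) x = tailPrimitive φ x + tailPrimitive ψ x := by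
  have hi : Integrable φ := φ.continuous.integrable_of_hasCompactSupport φ.hasCompactSupport
  have hj : Integrable ψ := ψ.continuous.integrable_of_hasCompactSupport ψ.hasCompactSupport
  exact integral_add hi.integrableOn hj.integrableOn

theorem tailPrimitive_smul (c : ℝ) (φ : 𝓓(halfLine, ℝ)) (x : ℝ) :
    tailPrimitive (c • φ : 𝓓(halfLine, ℝ)) x = c * tailPrimitive φ x :=
  integral_const_mul c _

theorem linCoag_add (φ ψ : 𝓓(halfLine, ℝ)) :
    linCoag (φ + ψ : 𝓓(halfLine, ℝ)) = linCoag φ + linCoag ψ := by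
  funext x
  have h1 : deriv (φ + ψ : 𝓓(halfLine, ℝ)) x = deriv φ x + deriv ψ x :=
    deriv_add (φ.contDiff.differentiable (by simp) x) (ψ.contDiff.differentiable (by simp) x)
  have h2 : ∀ χ : 𝓓(halfLine, ℝ), IntervalIntegrable
      (fun y => tailPrimitive χ y * Real.exp (-(x - y))) volume 0 x := fun χ =>
    ((continuous_tailPrimitive χ).mul (by fun_prop)).intervalIntegrable _ _
  simp only [linCoag, Pi.add_apply, h1, tailPrimitive_add, add_mul]
  rw [intervalIntegral.integral_add (h2 φ) (h2 ψ)]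
  ring

theorem linCoag_smul (c : ℝ) (φ : 𝓓(halfLine, ℝ)) :
    linCoag (c • φ : 𝓓(halfLine, ℝ)) = c • linCoag φ := by
  funext x
  have h1 : deriv (c • φ : 𝓓(halfLine, ℝ)) x = c * deriv φ x :=
    deriv_const_mul c (φ.contDiff.differentiable (by simp) x)
  simp only [linCoag, Pi.smul_apply, smul_eq_mul, h1, tailPrimitive_smul, mul_assoc]
  rw [intervalIntegral.integral_const_mul]
  ring

theorem continuous_linCoag (φ : 𝓓(halfLine, ℝ)) : Continuous (linCoag φ) := by
  have h : linCoag φ = fun x => x * deriv φ x - 2 * tailPrimitive φ x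
      + 2 * (Real.exp (-x) * ∫ y in (0 : ℝ)..x, tailPrimitive φ y * Real.exp y) := by
    funext x
    rw [linCoag, ← intervalIntegral.integral_const_mul (Real.exp (-x))]
    congr 3
    funext y
    rw [neg_sub, sub_eq_add_neg, Real.exp_add]
    ring
  have h1 : Continuous (deriv φ) := φ.contDiff.continuous_deriv (by simp)
  have h2 := continuous_tailPrimitive φ
  have h3 : Continuous fun x => ∫ y in (0 : ℝ)..x, tailPrimitive φ y * Real.exp y :=
    intervalIntegral.continuous_primitive
      (fun a b => (h2.mul Real.continuous_exp).intervalIntegrable a b) 0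
  rw [h]
  fun_prop

/-- Outside the support of `φ` the function `L₀[φ]` is a multiple of `e^{-x}`. -/
theorem linCoag_bound (φ : 𝓓(halfLine, ℝ)) :
    ∃ C : ℝ, ∀ x ∈ Ioi (0 : ℝ), |linCoag φ x| ≤ C * Real.exp (-x) := by
  obtain ⟨R, hR0, hR⟩ : ∃ R : ℝ, 0 < R ∧ ∀ x, R ≤ x → φ x = 0 := by
    obtain ⟨R, hR⟩ := φ.hasCompactSupport.isCompact.isBounded.subset_closedBall (0 : ℝ)
    refine ⟨max R 0 + 1, by positivity, fun x hx => ?_⟩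
    by_contra hne
    have := hR (subset_tsupport _ hne)
    rw [mem_closedBall_zero_iff, Real.norm_eq_abs] at this
    have h1 := le_abs_self x
    have h2 := le_max_left R 0
    linarith
  have hH : ∀ x, R ≤ x → tailPrimitive φ x = 0 := fun x hx => by
    rw [tailPrimitive, setIntegral_congr_fun (g := fun _ => (0 : ℝ)) measurableSet_Ioi
      (fun z hz => hR z (hx.trans (le_of_lt hz)))]
    simp
  have hd : ∀ x, R < x → deriv φ x = 0 := fun x hx => by
    have : (φ : ℝ → ℝ) =ᶠ[𝓝 x] fun _ => 0 := by
      filter_upwards [Ioi_mem_nhds hx] with z hz using hR z (le_of_lt hz)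
    rw [this.deriv_eq]
    simp
  have hcont := continuous_tailPrimitive φ
  set I : ℝ := ∫ y in (0 : ℝ)..R, tailPrimitive φ y * Real.exp y with hI
  obtain ⟨M, hM⟩ := (isCompact_Icc (a := (0 : ℝ)) (b := R)).exists_bound_of_continuousOn
    (f := fun x => Real.exp x * linCoag φ x)
    (Real.continuous_exp.mul (continuous_linCoag φ)).continuousOn
  refine ⟨max M |2 * I|, fun x hx => ?_⟩
  have key : |Real.exp x * linCoag φ x| ≤ max M |2 * I| := by
    rcases le_or_gt x R with h | h
    · exact (hM x ⟨le_of_lt hx, h⟩).trans (le_max_left _ _)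
    · refine le_trans (le_of_eq ?_) (le_max_right _ _)
      congr 1
      have e1 : ∫ y in (0 : ℝ)..x, tailPrimitive φ y * Real.exp (-(x - y))
          = Real.exp (-x) * I := by
        have hint : ∀ a b, IntervalIntegrable
            (fun y => tailPrimitive φ y * Real.exp (-(x - y))) volume a b := fun a b =>
          (hcont.mul (by fun_prop)).intervalIntegrable _ _
        rw [← intervalIntegral.integral_add_adjacent_intervals (hint 0 R) (hint R x)]
        have z : ∫ y in R..x, tailPrimitive φ y * Real.exp (-(x - y)) = 0 := by
          rw [intervalIntegral.integral_congr (g := fun _ => (0 : ℝ))]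
          · simp
          · intro y hy
            rw [uIcc_of_le h.le] at hy
            simp [hH y hy.1]
        rw [z, add_zero, hI, ← intervalIntegral.integral_const_mul]
        congr 1
        funext y
        rw [neg_sub, sub_eq_add_neg, Real.exp_add]
        ring
      rw [linCoag, hd x h, hH x h.le, e1]
      have : Real.exp x * Real.exp (-x) = 1 := by rw [← Real.exp_add]; simp
      linear_combination 2 * I * this
  rw [abs_mul, abs_of_pos (Real.exp_pos x)] at key
  rw [Real.exp_neg, ← div_eq_mul_inv, le_div_iff₀ (Real.exp_pos x)]
  linarith

/-- A continuous function that is `O(e^{-x})` on the half line lies in `L²(e^{μx})` if `μ < 2`. -/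
theorem memLp_of_bound {μ : ℝ} (hμ : μ < 2) {g : ℝ → ℝ} (hg : Continuous g) {C : ℝ}
    (hC : ∀ x ∈ Ioi (0 : ℝ), |g x| ≤ C * Real.exp (-x)) : MemLp g 2 (expMeasure μ) := by
  have hm : Measurable fun x : ℝ => ENNReal.ofReal (Real.exp (μ * x)) := by fun_prop
  rw [memLp_two_iff_integrable_sq hg.aestronglyMeasurable, expMeasure,
    integrable_withDensity_iff hm (by simp)]
  have hdom : IntegrableOn (fun x => C ^ 2 * Real.exp (-(2 - μ) * x)) (Ioi (0 : ℝ)) :=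
    (integrableOn_exp_mul_Ioi (by linarith) 0).const_mul _
  refine Integrable.mono' hdom
    ((hg.measurable.pow_const 2).mul hm.ennreal_toReal).aestronglyMeasurable ?_
  filter_upwards [ae_restrict_mem measurableSet_Ioi] with x hx
  rw [ENNReal.toReal_ofReal (Real.exp_pos _).le, Real.norm_eq_abs,
    abs_of_nonneg (by positivity)]
  have e : Real.exp (-(2 - μ) * x) = Real.exp (-x) ^ 2 * Real.exp (μ * x) := by
    rw [sq, ← Real.exp_add, ← Real.exp_add]
    congr 1
    ring
  rw [e, ← mul_assoc, ← mul_pow]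
  refine mul_le_mul_of_nonneg_right ?_ (Real.exp_pos _).le
  exact sq_le_sq' (by linarith [hC x hx, neg_abs_le (g x)]) ((le_abs_self _).trans (hC x hx))

theorem memLp_linCoag {μ : ℝ} (hμ : μ < 2) (φ : 𝓓(halfLine, ℝ)) :
    MemLp (linCoag φ) 2 (expMeasure μ) :=
  memLp_of_bound hμ (continuous_linCoag φ) (linCoag_bound φ).choose_spec

theorem memLp_testFunction {μ : ℝ} (hμ : μ < 2) (φ : 𝓓(halfLine, ℝ)) :
    MemLp φ 2 (expMeasure μ) := by
  obtain ⟨C, hC⟩ := (Real.continuous_exp.mul φ.continuous).bounded_above_of_compact_support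
    (φ.hasCompactSupport.mul_left (f := Real.exp))
  refine memLp_of_bound hμ φ.continuous (C := C) fun x _ => ?_
  have := hC x
  rw [Real.norm_eq_abs, Pi.mul_apply, abs_mul, abs_of_pos (Real.exp_pos x)] at this
  rw [Real.exp_neg, ← div_eq_mul_inv, le_div_iff₀ (Real.exp_pos x)]
  linarith

end MemLp

/-- The inclusion of `C_c^∞(0, ∞)` into `L²(e^{μx})`. -/
noncomputable def testToL2 (μ : ℝ) (hμ : μ < 2) : 𝓓(halfLine, ℝ) →ₗ[ℝ] L2Exp μ where
  toFun φ := (memLp_testFunction hμ φ).toLp φ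
  map_add' φ ψ := MemLp.toLp_add (memLp_testFunction hμ φ) (memLp_testFunction hμ ψ)
  map_smul' c φ := MemLp.toLp_const_smul c (memLp_testFunction hμ φ)

theorem testToL2_injective (μ : ℝ) (hμ : μ < 2) : Function.Injective (testToL2 μ hμ) := by
  intro φ ψ h
  have hm : Measurable fun x : ℝ => ENNReal.ofReal (Real.exp (μ * x)) := by fun_prop
  have h1 : (φ : ℝ → ℝ) =ᵐ[expMeasure μ] ψ := 
    (MemLp.toLp_eq_toLp_iff (memLp_testFunction hμ φ) (memLp_testFunction hμ ψ)).1 h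
  have h2 : (φ : ℝ → ℝ) =ᵐ[volume.restrict (Ioi 0)] ψ := by
    refine Filter.EventuallyEq.filter_mono h1 (Measure.AbsolutelyContinuous.ae_le ?_)
    exact withDensity_absolutelyContinuous' hm.aemeasurable
      (Eventually.of_forall fun x => by simp [Real.exp_pos])
  have h3 : EqOn φ ψ (Ioi 0) :=
    Measure.eqOn_open_of_ae_eq h2 isOpen_Ioi φ.continuous.continuousOn ψ.continuous.continuousOn
  ext x
  by_cases hx : x ∈ Ioi (0 : ℝ)
  · exact h3 hx
  · have z : ∀ χ : 𝓓(halfLine, ℝ), χ x = 0 := fun χ =>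
      image_eq_zero_of_notMem_tsupport fun h => hx (χ.tsupport_subset h)
    rw [z φ, z ψ]

/-- `φ ↦ L₀[φ]` as a linear map from `C_c^∞(0, ∞)` to `L²(e^{μx})`. -/
noncomputable def linCoagToL2 (μ : ℝ) (hμ : μ < 2) : 𝓓(halfLine, ℝ) →ₗ[ℝ] L2Exp μ where
  toFun φ := (memLp_linCoag hμ φ).toLp (linCoag φ)
  map_add' φ ψ := by
    rw [← MemLp.toLp_add]
    exact MemLp.toLp_congr _ _ (Eventually.of_forall (congrFun (linCoag_add φ ψ)))
  map_smul' c φ := by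
    rw [RingHom.id_apply, ← MemLp.toLp_const_smul]
    exact MemLp.toLp_congr _ _ (Eventually.of_forall (congrFun (linCoag_smul c φ)))

/-- The operator `L₀` as an unbounded operator on `L²(e^{μx})` with domain `C_c^∞(0, ∞)`. -/
noncomputable def linCoagOp (μ : ℝ) (hμ : μ < 2) : L2Exp μ →ₗ.[ℝ] L2Exp μ where
  domain := LinearMap.range (testToL2 μ hμ)
  toFun := (linCoagToL2 μ hμ).comp
    (LinearEquiv.ofInjective (testToL2 μ hμ) (testToL2_injective μ hμ)).symm.toLinearMap

/-- The graph of `L₀` consists of the pairs of classes of `φ` and `L₀[φ]`,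
`φ ∈ C_c^∞(0, ∞)`. -/
theorem mem_linCoagOp_graph_iff (μ : ℝ) (hμ : μ < 2) (f g : L2Exp μ) :
    (f, g) ∈ (linCoagOp μ hμ).graph ↔
      ∃ φ : 𝓓(halfLine, ℝ), f =ᵐ[expMeasure μ] φ ∧ g =ᵐ[expMeasure μ] linCoag φ := by
  rw [LinearPMap.mem_graph_iff]
  constructor
  · rintro ⟨⟨_, φ, rfl⟩, hz, hy⟩
    have e : (LinearEquiv.ofInjective (testToL2 μ hμ) (testToL2_injective μ hμ)).symm
        ⟨testToL2 μ hμ φ, φ, rfl⟩ = φ :=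
      (LinearEquiv.symm_apply_eq _).2 rfl
    replace hz : testToL2 μ hμ φ = f := hz
    refine ⟨φ, ?_, ?_⟩
    · rw [← hz]
      exact MemLp.coeFn_toLp (memLp_testFunction hμ φ)
    · have hy' : linCoagToL2 μ hμ φ = g := by
        exact (congrArg (linCoagToL2 μ hμ) e.symm).trans hy
      rw [← hy']
      exact MemLp.coeFn_toLp (memLp_linCoag hμ φ)
  · rintro ⟨φ, hf, hg⟩
    have e : (LinearEquiv.ofInjective (testToL2 μ hμ) (testToL2_injective μ hμ)).symm
        ⟨testToL2 μ hμ φ, φ, rfl⟩ = φ :=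
      (LinearEquiv.symm_apply_eq _).2 rfl
    refine ⟨⟨testToL2 μ hμ φ, φ, rfl⟩, ?_, ?_⟩
    · exact Lp.ext ((MemLp.coeFn_toLp (memLp_testFunction hμ φ)).trans hf.symm)
    · refine Eq.trans (congrArg (linCoagToL2 μ hμ) e) ?_
      exact Lp.ext ((MemLp.coeFn_toLp (memLp_linCoag hμ φ)).trans hg.symm)

/-! Write `J` for the tail primitive, `V` for convolution with `e^{-x}` and `D_t` for the dilation
`h ↦ h(e^t ·)`; then `L₀ = x d/dx - 2(1 - V)J`. The first term generates `D_t` and the second is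
bounded, by the Hardy-type energy estimates `weightedSq_tailPrimitive_le` and
`weightedSq_expConv_le`.

The semigroup is explicit. With `H = Jh`, the evolution becomes `∂_t H = xH' - H + 2VH`. Under the
Laplace transform this is a transport equation with solution `Ĥ(t,s) = ((1 + as)/(1 + s))² Ĥ₀(as)`,
`a = e^{-t}`. Multiplication by `(1 + as)/(1 + s)` is the operator `M_a = a + (1 - a)V`, so `J
e^{tL₀} = a⁻¹ M_a² D_t J`. Undoing `J` gives `coagOp`. The semigroup law follows from `M_a D_t M_b =
M_{ab} D_t` and injectivity of `J` on a dense invariant class of functions; no transform is used in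
the proof itself.

Differentiating the formula at `t = 0` shows that the generator is that of `D_t` plus the bounded
operator `-2(1 - V)J`. Test functions are dense and invariant under dilations, hence form a core for
the generator of `D_t` (`closure_eq_hasGen`), and a bounded perturbation preserves cores.

For the decay, `‖D_t‖ ≤ e^{-t/2}`; the only obstruction is the factor `a⁻¹ = e^t` in front of `(1 -
V)V D_t J h`. The identity `Vf + (1 - V)Jf = (∫ f) e^{-x}` with `f = D_t J h`, whose integral is a
multiple of `∫ x h = 0`, turns `V D_t J h` into `-a(1 - V) D_t J² h`, and the growth cancels. -/

namespace C0Semigroup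

/-! ### Orbits of semigroups and closedness of the generator. -/

section Orbit

variable {E : Type*} [NormedAddCommGroup E] [NormedSpace ℝ E] {T : C0Semigroup E}

theorem op_add_apply (T : C0Semigroup E) (s t : ℝ≥0) (x : E) :
    T.op (s + t) x = T.op s (T.op t x) := by
  rw [T.op_add]; rfl

theorem op_zero_apply (T : C0Semigroup E) (x : E) : T.op 0 x = x := by
  rw [T.op_zero]; rfl

theorem op_comm_apply (T : C0Semigroup E) (s t : ℝ≥0) (x : E) :
    T.op s (T.op t x) = T.op t (T.op s x) := by
  rw [← T.op_add_apply, add_comm, T.op_add_apply]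

theorem tendsto_toNNReal_sub (t : ℝ) :
    Tendsto (fun s : ℝ => (s - t).toNNReal) (𝓝[>] t) (𝓝[>] 0) := by
  refine tendsto_nhdsWithin_iff.2 ⟨?_, ?_⟩
  · have : Continuous fun s : ℝ => (s - t).toNNReal := by fun_prop
    simpa using (this.tendsto t).mono_left nhdsWithin_le_nhds
  · filter_upwards [self_mem_nhdsWithin] with s hs
    simpa using hs

/-- The orbit of `x` has right derivative `y` at `t` if `T t x` is mapped to `y` by the
generator. -/
theorem HasGen.hasDerivWithinAt_orbit {x y : E} {t : ℝ} (ht : 0 ≤ t)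
    (h : T.HasGen (T.op t.toNNReal x) y) :
    HasDerivWithinAt (fun s : ℝ => T.op s.toNNReal x) y (Ici t) t := by
  rw [← hasDerivWithinAt_Ioi_iff_Ici, hasDerivWithinAt_iff_tendsto_slope' (by simp)]
  refine (Tendsto.comp h (tendsto_toNNReal_sub t)).congr' ?_
  filter_upwards [self_mem_nhdsWithin] with s hs
  have hs' : 0 ≤ s - t := sub_nonneg.2 (le_of_lt hs)
  simp only [Function.comp_apply, slope, vsub_eq_sub]
  rw [← T.op_add_apply, ← Real.toNNReal_add hs' ht, sub_add_cancel, Real.coe_toNNReal _ hs']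

theorem HasGen.map_op {x y : E} (h : T.HasGen x y) (t : ℝ≥0) :
    T.HasGen (T.op t x) (T.op t y) := by
  refine (((T.op t).continuous.tendsto y).comp h).congr fun s => ?_
  simp [T.op_comm_apply t s]

theorem continuous_orbit_toNNReal (T : C0Semigroup E) (x : E) :
    Continuous fun s : ℝ => T.op s.toNNReal x :=
  (T.continuous_orbit x).comp continuous_real_toNNReal

/-- Mean value inequality for `s ↦ T_s x - s z`, whose right derivative is `T_s y - z`. -/
theorem HasGen.norm_op_sub_sub_le {x y z : E} (h : T.HasGen x y) {t : ℝ≥0} {C : ℝ}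
    (hC : ∀ s ≤ t, ‖T.op s y - z‖ ≤ C) : ‖T.op t x - x - t • z‖ ≤ C * t := by
  have key := norm_image_sub_le_of_norm_deriv_right_le_segment
    (f := fun s : ℝ => T.op s.toNNReal x - s • z) (f' := fun s => T.op s.toNNReal y - z)
    (a := 0) (b := t) (C := C)
    ((T.continuous_orbit_toNNReal x).sub (by fun_prop)).continuousOn
    (fun s hs => ((h.map_op s.toNNReal).hasDerivWithinAt_orbit hs.1).sub
      (by simpa using ((hasDerivAt_id s).smul_const z).hasDerivWithinAt))
    (fun s hs => hC _ (Real.toNNReal_le_iff_le_coe.2 hs.2.le)) t ⟨t.2, le_rfl⟩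
  simp only [Real.toNNReal_coe, Real.toNNReal_zero, op_zero_apply, zero_smul, sub_zero] at key
  rwa [sub_right_comm] at key

/-- The generator of a contraction semigroup is closed. -/
theorem isClosed_hasGen (hT : ∀ t x, ‖T.op t x‖ ≤ ‖x‖) :
    IsClosed {p : E × E | T.HasGen p.1 p.2} := by
  refine isClosed_of_closure_subset fun ⟨x, y⟩ hp => ?_
  -- For fixed `t` the estimate, with the error `‖p.2 - y‖` added, is a closed condition on the pair
  -- `p`. It holds on the graph by contractivity, so it survives at the limit point `(x, y)`, where
  -- the error vanishes.
  have key : ∀ (t : ℝ≥0) (C : ℝ), (∀ s ≤ t, ‖T.op s y - y‖ ≤ C) →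
      ‖T.op t x - x - t • y‖ ≤ C * t := by
    intro t C hC
    have hcl : IsClosed {p : E × E | ‖T.op t p.1 - p.1 - t • y‖ ≤ (‖p.2 - y‖ + C) * t} := by
      refine isClosed_le ?_ ?_ <;> fun_prop
    have := closure_minimal (s := {p : E × E | T.HasGen p.1 p.2}) (fun p hp => ?_) hcl hp
    · simpa using this
    · refine HasGen.norm_op_sub_sub_le hp fun s hs => ?_
      have e : T.op s p.2 - y = T.op s (p.2 - y) + (T.op s y - y) := by
        rw [map_sub]; abel
      rw [e]
      exact (norm_add_le _ _).trans (add_le_add (hT _ _) (hC s hs))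
  rw [mem_ofPred_eq, HasGen, Metric.tendsto_nhds]
  intro ε hε
  have h0 := (T.continuous_orbit y).tendsto 0
  rw [T.op_zero_apply] at h0
  obtain ⟨δ, hδ, hb⟩ := Metric.eventually_nhds_iff.1 (Metric.tendsto_nhds.1 h0 (ε / 2) (half_pos hε))
  have hδ' : ∀ᶠ t : ℝ≥0 in 𝓝[>] 0, dist t 0 < δ :=
    nhdsWithin_le_nhds (Metric.ball_mem_nhds 0 hδ)
  filter_upwards [hδ', self_mem_nhdsWithin] with t ht ht0
  have ht0' : (0 : ℝ) < t := ht0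
  have h1 := key t (ε / 2) fun s hs => by
    rw [← dist_eq_norm]
    refine (hb (lt_of_le_of_lt ?_ ht)).le
    simpa [NNReal.dist_eq] using hs
  have e : (t : ℝ)⁻¹ • (T.op t x - x) - y = (t : ℝ)⁻¹ • (T.op t x - x - t • y) := by
    rw [smul_sub _ (T.op t x - x), NNReal.smul_def, inv_smul_smul₀ ht0'.ne']
  rw [dist_eq_norm, e, norm_smul, norm_inv, Real.norm_of_nonneg ht0'.le,
    inv_mul_lt_iff₀ ht0']
  nlinarith

end Orbit

/-! ### Dissipativity, cores and bounded perturbations. -/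

section Core

variable {E : Type*} [NormedAddCommGroup E] [InnerProductSpace ℝ E] {T : C0Semigroup E}

/-- The generator of a contraction semigroup is dissipative. -/
theorem HasGen.norm_le_norm_sub (hT : ∀ t x, ‖T.op t x‖ ≤ ‖x‖) {x y : E} (h : T.HasGen x y) :
    ‖x‖ ≤ ‖x - y‖ := by
  -- Contractivity gives `⟨x, T_t x - x⟩ ≤ ‖x‖² - ‖x‖² = 0`; divide by `t` and pass to the limit.
  have h1 : inner ℝ x y ≤ 0 := by
    refine le_of_tendsto (Tendsto.inner (𝕜 := ℝ) tendsto_const_nhds h)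
      (Eventually.of_forall fun t => ?_)
    rw [inner_smul_right, inner_sub_right, real_inner_self_eq_norm_sq]
    have := real_inner_le_norm x (T.op t x)
    have := mul_le_mul_of_nonneg_left (hT t x) (norm_nonneg x)
    exact mul_nonpos_of_nonneg_of_nonpos (by positivity) (by nlinarith)
  have h2 := real_inner_le_norm x (x - y)
  rw [inner_sub_right, real_inner_self_eq_norm_sq] at h2
  by_contra! hlt
  have hx : 0 < ‖x‖ := (norm_nonneg _).trans_lt hlt
  nlinarith [mul_lt_mul_of_pos_left hlt hx]

/-- Core theorem: a densely defined restriction of the generator of a contraction semigroup on a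
Hilbert space, whose domain is invariant under the semigroup, has the generator as closure. -/
theorem closure_eq_hasGen [CompleteSpace E] (hT : ∀ t x, ‖T.op t x‖ ≤ ‖x‖)
    (S : Submodule ℝ (E × E)) (hS : ∀ p ∈ S, T.HasGen p.1 p.2)
    (hdense : Dense (Prod.fst '' (S : Set (E × E))))
    (hinv : ∀ p ∈ S, ∀ t, ∃ y, (T.op t p.1, y) ∈ S) :
    closure (S : Set (E × E)) = {p : E × E | T.HasGen p.1 p.2} := by
  refine Subset.antisymm (closure_minimal hS (isClosed_hasGen hT)) ?_
  set K : Submodule ℝ E := S.map (LinearMap.fst ℝ E E - LinearMap.snd ℝ E E) with hK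
  have hKmem : ∀ p ∈ S, p.1 - p.2 ∈ K := fun p hp => ⟨p, hp, rfl⟩
  -- The range of `1 - A` on the domain of `S` is dense: if `g` is orthogonal to it, invariance
  -- gives `F' = F` for `F(t) = ⟨g, T_t p⟩`, so `F(t) = e^t F(0)`. As `F` is bounded, `F(0) = 0`,
  -- and density of the domain forces `g = 0`.
  have hKd : Dense (K : Set E) := by
    rw [Submodule.dense_iff_topologicalClosure_eq_top, Submodule.topologicalClosure_eq_top_iff, Submodule.eq_bot_iff]
    intro g hg
    refine hdense.eq_zero_of_inner_left ℝ ?_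
    rintro _ ⟨p, hp, rfl⟩
    have horth : ∀ q ∈ S, inner ℝ g q.2 = inner ℝ g q.1 := fun q hq => by
      have := (Submodule.mem_orthogonal' _ _).1 hg _ (hKmem q hq)
      rw [inner_sub_right] at this
      linarith
    set F : ℝ → ℝ := fun t => inner ℝ g (T.op t.toNNReal p.1) with hF
    have hFd : ∀ t, 0 ≤ t → HasDerivWithinAt F (F t) (Ici t) t := by
      intro t ht
      obtain ⟨y, hy⟩ := hinv p hp t.toNNReal
      have h1 := HasGen.hasDerivWithinAt_orbit ht (hS _ hy)
      have h2 := (hasDerivWithinAt_const t (Ici t) g).inner ℝ h1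
      simpa [horth _ hy] using h2
    have hconst : ∀ t, 0 ≤ t → Real.exp (-t) * F t = F 0 := by
      intro t ht
      have := constant_of_has_deriv_right_zero (f := fun t => Real.exp (-t) * F t)
        (a := 0) (b := t) ?_ ?_ t ⟨ht, le_rfl⟩
      · simpa using this
      · refine Continuous.continuousOn (Continuous.mul (by fun_prop) ?_)
        exact continuous_const.inner (T.continuous_orbit_toNNReal p.1)
      · intro s hs
        have h1 : HasDerivWithinAt (fun t : ℝ => Real.exp (-t)) (-Real.exp (-s)) (Ici s) s := by
          simpa using ((hasDerivAt_neg s).exp).hasDerivWithinAt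
        exact (h1.mul (hFd s hs.1)).congr_deriv (by ring)
    have hlim : Tendsto (fun t : ℝ => Real.exp (-t) * (‖g‖ * ‖p.1‖)) atTop (𝓝 0) := by
      simpa using (Real.tendsto_exp_neg_atTop_nhds_zero).mul_const (‖g‖ * ‖p.1‖)
    have hF0 : |F 0| ≤ 0 := by
      refine ge_of_tendsto hlim ?_
      filter_upwards [eventually_ge_atTop 0] with t ht
      rw [← hconst t ht, abs_mul, abs_of_pos (Real.exp_pos _)]
      refine mul_le_mul_of_nonneg_left ?_ (Real.exp_pos _).le
      exact (abs_real_inner_le_norm _ _).trans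
        (mul_le_mul_of_nonneg_left (hT _ _) (norm_nonneg _))
    have := abs_nonpos_iff.1 hF0
    simpa [hF, op_zero_apply] using this
  rintro ⟨x, y⟩ hxy
  refine Metric.mem_closure_iff.2 fun ε hε => ?_
  -- Approximating `x - y` in the range suffices: dissipativity bounds `‖x - p.1‖` by the error, and
  -- then `y - p.2` is a difference of two small vectors.
  obtain ⟨_, ⟨p, hp, rfl⟩, hlt⟩ := Metric.mem_closure_iff.1 (hKd (x - y)) (ε / 2) (half_pos hε)
  refine ⟨p, hp, ?_⟩
  have hsub : T.HasGen (x - p.1) (y - p.2) := by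
    simpa [sub_eq_add_neg] using HasGen.add hxy ((hS p hp).smul (-1))
  have h1 := hsub.norm_le_norm_sub hT
  have e1 : x - p.1 - (y - p.2) = x - y - (p.1 - p.2) := by abel
  have h2 : ‖x - y - (p.1 - p.2)‖ < ε / 2 := by simpa [dist_eq_norm] using hlt
  rw [e1] at h1
  have e2 : y - p.2 = (x - p.1) - (x - y - (p.1 - p.2)) := by abel
  have h3 : ‖y - p.2‖ < ε := by
    rw [e2]
    linarith [norm_sub_le (x - p.1) (x - y - (p.1 - p.2))]
  rw [Prod.dist_eq, max_lt_iff, dist_eq_norm, dist_eq_norm]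
  exact ⟨by simpa using lt_of_le_of_lt h1 (by linarith), by simpa using h3⟩

/-- An operator `L` generates the semigroup `T` if, after subtraction of a bounded operator `B`,
it becomes a densely defined restriction with invariant domain of the generator of a contraction
semigroup `D` such that the generator of `T` is the generator of `D` plus `B`. -/
theorem generates_of_perturbation [CompleteSpace E] {D : C0Semigroup E}
    (hD : ∀ t x, ‖D.op t x‖ ≤ ‖x‖) (B : E →L[ℝ] E)
    (hTD : ∀ x y, T.HasGen x y ↔ D.HasGen x (y - B x)) (L : E →ₗ.[ℝ] E)
    (hL : ∀ p ∈ L.graph, D.HasGen p.1 (p.2 - B p.1)) (hdense : Dense (L.domain : Set E))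
    (hinv : ∀ x ∈ L.domain, ∀ t, D.op t x ∈ L.domain) : Generates L T := by
  let sh : (E × E) →L[ℝ] (E × E) :=
    (ContinuousLinearMap.fst ℝ E E).prod
      (ContinuousLinearMap.snd ℝ E E + B.comp (ContinuousLinearMap.fst ℝ E E))
  -- The shear carrying the graph of `L - B` onto that of `L`; being a homeomorphism, it commutes
  -- with closure.
  let hom : (E × E) ≃ₜ (E × E) :=
    { toFun := fun p => (p.1, p.2 + B p.1)
      invFun := fun p => (p.1, p.2 - B p.1)
      left_inv := fun p => by simp
      right_inv := fun p => by simp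
      continuous_toFun := by fun_prop
      continuous_invFun := by fun_prop }
  have hgraph : ∀ x ∈ L.domain, ∃ y, (x, y) ∈ L.graph := fun x hx =>
    ⟨_, L.mem_graph ⟨x, hx⟩⟩
  have hcore := closure_eq_hasGen hD (L.graph.comap sh.toLinearMap)
    (fun p hp => by simpa [sh] using hL _ hp)
    (hdense.mono fun x hx => by
      obtain ⟨y, hy⟩ := hgraph x hx
      exact ⟨(x, y - B x), by simpa [sh] using hy, rfl⟩)
    (fun p hp t => by
      obtain ⟨y, hy⟩ := hgraph _ (hinv p.1 (LinearPMap.mem_domain_of_mem_graph hp) t)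
      exact ⟨y - B (D.op t p.1), by simpa [sh] using hy⟩)
  have hcl : L.graph.topologicalClosure = T.generator.graph := by
    ext ⟨x, y⟩
    rw [T.mem_generator_graph_iff, hTD, ← SetLike.mem_coe, Submodule.topologicalClosure_coe]
    have e : (hom ⁻¹' closure (L.graph : Set (E × E))) = {p : E × E | D.HasGen p.1 p.2} := by
      rw [hom.preimage_closure, ← hcore]
      rfl
    have := congrArg (fun s : Set (E × E) => (x, y - B x) ∈ s) e
    simpa [hom] using this
  have hclos : L.IsClosable := ⟨_, hcl⟩
  exact ⟨hclos, LinearPMap.eq_of_eq_graph (hclos.graph_closure_eq_closure_graph.symm.trans hcl)⟩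

end Core

end C0Semigroup

/-! ### Continuous functions of exponential decay -/

theorem integrableOn_Ioi_of_exp_bound {g : ℝ → ℝ} (hg : Continuous g) {C b : ℝ} (hb : 0 < b)
    (hC : ∀ x, 0 ≤ x → |g x| ≤ C * Real.exp (-b * x)) : IntegrableOn g (Ioi 0) := by
  refine Integrable.mono' ((integrableOn_exp_mul_Ioi (neg_lt_zero.2 hb) 0).const_mul C)
    hg.aestronglyMeasurable ?_
  filter_upwards [ae_restrict_mem measurableSet_Ioi] with x hx using hC x (le_of_lt hx)

theorem tendsto_exp_neg_mul_atTop {b : ℝ} (hb : 0 < b) :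
    Tendsto (fun x : ℝ => Real.exp (-b * x)) atTop (𝓝 0) :=
  Real.tendsto_exp_atBot.comp (tendsto_id.const_mul_atTop_of_neg (neg_lt_zero.2 hb))

theorem tendsto_zero_of_exp_bound {g : ℝ → ℝ} {C b : ℝ} (hb : 0 < b)
    (hC : ∀ x, 0 ≤ x → |g x| ≤ C * Real.exp (-b * x)) : Tendsto g atTop (𝓝 0) := by
  have hlim : Tendsto (fun x : ℝ => C * Real.exp (-b * x)) atTop (𝓝 0) := by
    simpa using (tendsto_exp_neg_mul_atTop hb).const_mul C
  refine squeeze_zero_norm' ?_ hlim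
  filter_upwards [eventually_ge_atTop 0] with x hx using hC x hx

/-- The space of continuous functions that are `O(e^{-x/2})` on the half line. -/
def expDecay : Submodule ℝ (ℝ → ℝ) where
  carrier := {f | Continuous f ∧ ∃ C, ∀ x, 0 ≤ x → |f x| ≤ C * Real.exp (-(1 / 2) * x)}
  zero_mem' := ⟨continuous_const, 0, by simp⟩
  add_mem' := by
    rintro f g ⟨hf, C, hC⟩ ⟨hg, C', hC'⟩
    refine ⟨hf.add hg, C + C', fun x hx => ?_⟩
    rw [add_mul]
    exact (abs_add_le _ _).trans (add_le_add (hC x hx) (hC' x hx))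
  smul_mem' := by
    rintro c f ⟨hf, C, hC⟩
    refine ⟨hf.const_smul c, |c| * C, fun x hx => ?_⟩
    rw [Pi.smul_apply, smul_eq_mul, abs_mul, mul_assoc]
    exact mul_le_mul_of_nonneg_left (hC x hx) (abs_nonneg c)

namespace expDecay

theorem exists_bound {f : ℝ → ℝ} (hf : f ∈ expDecay) :
    ∃ C, 0 ≤ C ∧ ∀ x, 0 ≤ x → |f x| ≤ C * Real.exp (-(1 / 2) * x) := by
  obtain ⟨C, hC⟩ := hf.2
  refine ⟨C, ?_, hC⟩
  simpa using (abs_nonneg _).trans (hC 0 le_rfl)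

theorem integrableOn_Ioi {f : ℝ → ℝ} (hf : f ∈ expDecay) (a : ℝ) : IntegrableOn f (Ioi a) := by
  obtain ⟨C, hC⟩ := hf.2
  have h0 := integrableOn_Ioi_of_exp_bound hf.1 one_half_pos hC
  rcases le_total 0 a with h | h
  · exact h0.mono_set (Ioi_subset_Ioi h)
  · rw [← Ioc_union_Ioi_eq_Ioi h]
    exact (hf.1.integrableOn_Ioc).union h0

theorem tendsto_zero {f : ℝ → ℝ} (hf : f ∈ expDecay) : Tendsto f atTop (𝓝 0) :=
  let ⟨_, hC⟩ := hf.2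
  tendsto_zero_of_exp_bound one_half_pos hC

/-! #### Dilations -/

theorem comp_mul_left {f : ℝ → ℝ} (hf : f ∈ expDecay) {c : ℝ} (hc : 1 ≤ c) :
    (fun x => f (c * x)) ∈ expDecay := by
  obtain ⟨C, hC0, hC⟩ := exists_bound hf
  refine ⟨hf.1.comp (by fun_prop), C, fun x hx => (hC _ (by positivity)).trans ?_⟩
  gcongr ?_ * ?_
  rw [Real.exp_le_exp]
  nlinarith

/-! #### The tail primitive -/

theorem tailPrimitive_eq_sub {f : ℝ → ℝ} (hf : f ∈ expDecay) (x : ℝ) :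
    tailPrimitive f x = (∫ z in Ioi 0, f z) - ∫ z in (0 : ℝ)..x, f z := by
  have := intervalIntegral.integral_interval_add_Ioi (f := f) (μ := volume) (a := 0) (b := x)
    (integrableOn_Ioi hf 0) (integrableOn_Ioi hf x)
  rw [tailPrimitive]
  linarith

theorem hasDerivAt_tailPrimitive {f : ℝ → ℝ} (hf : f ∈ expDecay) (x : ℝ) :
    HasDerivAt (tailPrimitive f) (-f x) x := by
  have h : tailPrimitive f = fun x => (∫ z in Ioi 0, f z) - ∫ z in (0 : ℝ)..x, f z :=
    funext (tailPrimitive_eq_sub hf)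
  rw [h]
  exact (hf.1.integral_hasStrictDerivAt 0 x).hasDerivAt.const_sub _

theorem tailPrimitive_mem {f : ℝ → ℝ} (hf : f ∈ expDecay) : tailPrimitive f ∈ expDecay := by
  obtain ⟨C, hC0, hC⟩ := exists_bound hf
  refine ⟨continuous_iff_continuousAt.2 fun x => (hasDerivAt_tailPrimitive hf x).continuousAt,
    2 * C, fun x hx => ?_⟩
  have hlt : (-(1 / 2) : ℝ) < 0 := by norm_num
  have h1 : |tailPrimitive f x| ≤ ∫ z in Ioi x, C * Real.exp (-(1 / 2) * z) := by
    rw [tailPrimitive, ← Real.norm_eq_abs]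
    refine norm_integral_le_of_norm_le ((integrableOn_exp_mul_Ioi hlt x).const_mul C) ?_
    filter_upwards [ae_restrict_mem measurableSet_Ioi] with z hz
    exact hC z (hx.trans (le_of_lt hz))
  refine h1.trans (le_of_eq ?_)
  rw [integral_const_mul, integral_exp_mul_Ioi hlt]
  ring

end expDecay

/-! #### Convolution with the exponential -/

/-- The convolution `∫_0^x f(y) e^{-(x-y)} dy`. -/
noncomputable def expConv (f : ℝ → ℝ) (x : ℝ) : ℝ :=
  ∫ y in (0 : ℝ)..x, f y * Real.exp (-(x - y))

theorem expConv_eq (f : ℝ → ℝ) (x : ℝ) :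
    expConv f x = Real.exp (-x) * ∫ y in (0 : ℝ)..x, f y * Real.exp y := by
  rw [expConv, ← intervalIntegral.integral_const_mul]
  congr 1
  funext y
  rw [neg_sub, sub_eq_add_neg, Real.exp_add]
  ring

theorem expConv_zero_right (f : ℝ → ℝ) : expConv f 0 = 0 := by
  simp [expConv]

theorem expConv_add {f g : ℝ → ℝ} (hf : Continuous f) (hg : Continuous g) :
    expConv (f + g) = expConv f + expConv g := by
  funext x
  simp only [expConv, Pi.add_apply, add_mul]
  exact intervalIntegral.integral_add
    ((hf.mul (by fun_prop)).intervalIntegrable _ _) ((hg.mul (by fun_prop)).intervalIntegrable _ _)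

theorem expConv_smul (c : ℝ) (f : ℝ → ℝ) : expConv (c • f) = c • expConv f := by
  funext x
  simp only [expConv, Pi.smul_apply, smul_eq_mul, mul_assoc]
  exact intervalIntegral.integral_const_mul _ _

theorem hasDerivAt_expConv {f : ℝ → ℝ} (hf : Continuous f) (x : ℝ) :
    HasDerivAt (expConv f) (f x - expConv f x) x := by
  have h1 : HasDerivAt (fun x => ∫ y in (0 : ℝ)..x, f y * Real.exp y) (f x * Real.exp x) x :=
    ((hf.mul Real.continuous_exp).integral_hasStrictDerivAt 0 x).hasDerivAt
  have h2 : HasDerivAt (fun x : ℝ => Real.exp (-x)) (-Real.exp (-x)) x := by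
    simpa using (hasDerivAt_neg x).exp
  rw [funext (expConv_eq f)]
  refine (h2.mul h1).congr_deriv ?_
  have : Real.exp (-x) * Real.exp x = 1 := by rw [← Real.exp_add]; simp
  linear_combination f x * this

/-- Convolution of `u + u'` with the exponential. -/
theorem expConv_add_deriv {u g : ℝ → ℝ} (hg : Continuous g)
    (hu : ∀ x, HasDerivAt u (g x - u x) x) (x : ℝ) :
    expConv g x = u x - u 0 * Real.exp (-x) := by
  have h1 : ∀ y ∈ uIcc 0 x, HasDerivAt (fun y => u y * Real.exp y) (g y * Real.exp y) y :=
    fun y _ => ((hu y).mul (Real.hasDerivAt_exp y)).congr_deriv (by ring)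
  rw [expConv_eq, intervalIntegral.integral_eq_sub_of_hasDerivAt h1
    ((hg.mul Real.continuous_exp).intervalIntegrable _ _)]
  have : Real.exp (-x) * Real.exp x = 1 := by rw [← Real.exp_add]; simp
  simp only [Real.exp_zero]
  linear_combination u x * this

namespace expDecay

/-- The decay rate `1/2` is slower than that of the kernel `e^{-x}`, so convolution does not spoil
it. -/
theorem expConv_mem {f : ℝ → ℝ} (hf : f ∈ expDecay) : expConv f ∈ expDecay := by
  obtain ⟨C, hC0, hC⟩ := exists_bound hf
  refine ⟨continuous_iff_continuousAt.2 fun x => (hasDerivAt_expConv hf.1 x).continuousAt,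
    2 * C, fun x hx => ?_⟩
  have h1 : |∫ y in (0 : ℝ)..x, f y * Real.exp y| ≤
      ∫ y in (0 : ℝ)..x, C * Real.exp (1 / 2 * y) := by
    rw [← Real.norm_eq_abs]
    refine intervalIntegral.norm_integral_le_of_norm_le hx ?_
      (Continuous.intervalIntegrable (by fun_prop) _ _)
    filter_upwards with y hy
    rw [norm_mul, Real.norm_eq_abs, Real.norm_of_nonneg (Real.exp_pos y).le]
    refine (mul_le_mul_of_nonneg_right (hC y hy.1.le) (Real.exp_pos y).le).trans (le_of_eq ?_)
    rw [mul_assoc, ← Real.exp_add]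
    ring_nf
  have h2 : ∫ y in (0 : ℝ)..x, C * Real.exp (1 / 2 * y) = 2 * C * (Real.exp (1 / 2 * x) - 1) := by
    rw [intervalIntegral.integral_eq_sub_of_hasDerivAt (f := fun y => 2 * C * Real.exp (1 / 2 * y))]
    · simp; ring
    · intro y _
      refine ((((hasDerivAt_id y).const_mul (1 / 2 : ℝ)).exp).const_mul (2 * C)).congr_deriv ?_
      simp; ring
    · exact Continuous.intervalIntegrable (by fun_prop) _ _
  rw [expConv_eq, abs_mul, abs_of_pos (Real.exp_pos _)]
  have e : Real.exp (-(1 / 2) * x) = Real.exp (-x) * Real.exp (1 / 2 * x) := by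
    rw [← Real.exp_add]; ring_nf
  have h3 : Real.exp (-x) * |∫ y in (0 : ℝ)..x, f y * Real.exp y| ≤
      Real.exp (-x) * (2 * C * (Real.exp (1 / 2 * x) - 1)) :=
    mul_le_mul_of_nonneg_left (h1.trans h2.le) (Real.exp_pos _).le
  rw [e]
  nlinarith [mul_nonneg hC0 (Real.exp_pos (-x)).le]

/-! #### Relations between the operators -/

theorem tailPrimitive_comp_mul_left (f : ℝ → ℝ) {c : ℝ} (hc : 0 < c) (x : ℝ) :
    tailPrimitive (fun z => f (c * z)) x = c⁻¹ * tailPrimitive f (c * x) :=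
  integral_comp_mul_left_Ioi f x hc

/-- Integrate `(Vf)' = f - Vf` over `(x, ∞)`. In operator form, `J(1 - V) = -V`. -/
theorem tailPrimitive_expConv {f : ℝ → ℝ} (hf : f ∈ expDecay) (x : ℝ) :
    tailPrimitive (expConv f) x = tailPrimitive f x + expConv f x := by
  have hV := expConv_mem hf
  have h := integral_Ioi_of_hasDerivAt_of_tendsto' (a := x)
    (fun y _ => hasDerivAt_expConv hf.1 y)
    ((integrableOn_Ioi hf x).sub (integrableOn_Ioi hV x)) (tendsto_zero hV)
  rw [integral_sub (integrableOn_Ioi hf x) (integrableOn_Ioi hV x)] at h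
  simp only [tailPrimitive]
  linarith

/-- The function `u = (Vf)(c ·)` vanishes at `0` and satisfies `u + u' = (1 - c)u + c f(c ·)`;
convolving this with the exponential recovers `u`. -/
theorem expConv_dilation {f : ℝ → ℝ} (hf : f ∈ expDecay) {c : ℝ} (hc : 1 ≤ c) (x : ℝ) :
    expConv (fun y => f (c * y)) x =
      c⁻¹ * expConv f (c * x) + (1 - c⁻¹) * expConv (fun y => expConv f (c * y)) x := by
  have hV := comp_mul_left (expConv_mem hf) hc
  have hfc := comp_mul_left hf hc
  have hc0 : c ≠ 0 := by positivity
  have h := expConv_add_deriv (u := fun y => expConv f (c * y))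
    (g := (1 - c) • (fun y => expConv f (c * y)) + c • fun y => f (c * y))
    ((hV.1.const_smul _).add (hfc.1.const_smul _)) (fun y => by
      have h1 : HasDerivAt (fun y => c * y) c y := by simpa using (hasDerivAt_id y).const_mul c
      refine ((hasDerivAt_expConv hf.1 (c * y)).comp y h1).congr_deriv ?_
      simp only [Pi.add_apply, Pi.smul_apply, smul_eq_mul]
      ring) x
  rw [expConv_add (hV.1.const_smul _) (hfc.1.const_smul _), expConv_smul, expConv_smul] at h
  simp only [Pi.add_apply, Pi.smul_apply, smul_eq_mul, mul_zero, expConv_zero_right, zero_mul,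
    sub_zero] at h
  field_simp
  linarith

/-- Apply `expConv_add_deriv` to `u = Jf`, where `u + u' = Jf - f`; the right side is the boundary
term `u(0)e^{-x}`. It disappears for functions of zero integral, which is what the decay estimate
exploits. -/
theorem expConv_tailPrimitive {f : ℝ → ℝ} (hf : f ∈ expDecay) (x : ℝ) :
    expConv f x + (tailPrimitive f x - expConv (tailPrimitive f) x) =
      (∫ z in Ioi 0, f z) * Real.exp (-x) := by
  have hJ := tailPrimitive_mem hf
  have h := expConv_add_deriv (u := tailPrimitive f) (g := tailPrimitive f + (-1 : ℝ) • f)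
    (hJ.1.add (hf.1.const_smul _))
    (fun y => (hasDerivAt_tailPrimitive hf y).congr_deriv (by simp)) x
  rw [expConv_add hJ.1 (hf.1.const_smul _), expConv_smul] at h
  simp only [Pi.add_apply, Pi.smul_apply, smul_eq_mul] at h
  rw [show (∫ z in Ioi 0, f z) = tailPrimitive f 0 from rfl]
  linarith

theorem abs_id_mul_le {f : ℝ → ℝ} (hf : f ∈ expDecay) :
    ∃ C, ∀ x, 0 ≤ x → |x * f x| ≤ C * Real.exp (-(1 / 4) * x) := by
  obtain ⟨C, hC0, hC⟩ := exists_bound hf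
  refine ⟨4 * C, fun x hx => ?_⟩
  rw [abs_mul, abs_of_nonneg hx]
  have h1 : x ≤ 4 * Real.exp (1 / 4 * x) := by
    linarith [Real.add_one_le_exp (1 / 4 * x)]
  have e : Real.exp (-(1 / 4) * x) = Real.exp (1 / 4 * x) * Real.exp (-(1 / 2) * x) := by
    rw [← Real.exp_add]; ring_nf
  rw [e]
  calc x * |f x| ≤ 4 * Real.exp (1 / 4 * x) * (C * Real.exp (-(1 / 2) * x)) :=
        mul_le_mul h1 (hC x hx) (abs_nonneg _) (by positivity)
    _ = _ := by ring

/-- Integrate `(x Jf)' = Jf - x f`; both boundary terms vanish. -/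
theorem integral_tailPrimitive {f : ℝ → ℝ} (hf : f ∈ expDecay) :
    ∫ x in Ioi (0 : ℝ), tailPrimitive f x = ∫ x in Ioi (0 : ℝ), x * f x := by
  have hJ := tailPrimitive_mem hf
  obtain ⟨C, hC⟩ := abs_id_mul_le hf
  obtain ⟨C', hC'⟩ := abs_id_mul_le hJ
  have hq : (0 : ℝ) < 1 / 4 := by norm_num
  have hi : IntegrableOn (fun x => x * f x) (Ioi 0) :=
    integrableOn_Ioi_of_exp_bound (continuous_id.mul hf.1) hq hC
  have h := integral_Ioi_of_hasDerivAt_of_tendsto' (a := 0)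
    (f := fun x => x * tailPrimitive f x) (f' := fun x => tailPrimitive f x - x * f x)
    (fun x _ => ((hasDerivAt_id x).mul (hasDerivAt_tailPrimitive hf x)).congr_deriv
      (by simp; ring))
    ((integrableOn_Ioi hJ 0).sub hi) (tendsto_zero_of_exp_bound hq hC')
  rw [integral_sub (integrableOn_Ioi hJ 0) hi] at h
  linarith

/-! #### Weighted estimates -/

theorem exists_mul_weight_bound {f g : ℝ → ℝ} (hf : f ∈ expDecay) (hg : g ∈ expDecay) (μ : ℝ) :
    ∃ C, ∀ x, 0 ≤ x → |f x * g x * Real.exp (μ * x)| ≤ C * Real.exp (-(1 - μ) * x) := by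
  obtain ⟨C, hC0, hC⟩ := exists_bound hf
  obtain ⟨C', hC0', hC'⟩ := exists_bound hg
  refine ⟨C * C', fun x hx => ?_⟩
  have e : Real.exp (-(1 - μ) * x) =
      Real.exp (-(1 / 2) * x) * Real.exp (-(1 / 2) * x) * Real.exp (μ * x) := by
    rw [← Real.exp_add, ← Real.exp_add]; ring_nf
  rw [e, abs_mul, abs_mul, abs_of_pos (Real.exp_pos _)]
  calc |f x| * |g x| * Real.exp (μ * x)
      ≤ C * Real.exp (-(1 / 2) * x) * (C' * Real.exp (-(1 / 2) * x)) * Real.exp (μ * x) :=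
        mul_le_mul_of_nonneg_right (mul_le_mul (hC x hx) (hC' x hx) (abs_nonneg _)
          (by positivity)) (Real.exp_pos _).le
    _ = _ := by ring

theorem integrableOn_mul_weight {f g : ℝ → ℝ} (hf : f ∈ expDecay) (hg : g ∈ expDecay) {μ : ℝ}
    (hμ : μ < 1) : IntegrableOn (fun x => f x * g x * Real.exp (μ * x)) (Ioi 0) :=
  let ⟨_, hC⟩ := exists_mul_weight_bound hf hg μ
  integrableOn_Ioi_of_exp_bound ((hf.1.mul hg.1).mul (by fun_prop)) (sub_pos.2 hμ) hC

/-- The square of the norm of `f` in `L²(e^{μx})`. -/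
noncomputable def weightedSq (μ : ℝ) (f : ℝ → ℝ) : ℝ :=
  ∫ x in Ioi (0 : ℝ), f x * f x * Real.exp (μ * x)

/-- Integrate the derivative of `u² e^{μx}` over the half line. -/
theorem energy_identity {u w : ℝ → ℝ} (hu : u ∈ expDecay) (hw : w ∈ expDecay)
    (hd : ∀ x, HasDerivAt u (w x) x) {μ : ℝ} (hμ : μ < 1) :
    2 * (∫ x in Ioi (0 : ℝ), u x * w x * Real.exp (μ * x)) + μ * weightedSq μ u = -u 0 ^ 2 := by
  obtain ⟨C, hC⟩ := exists_mul_weight_bound hu hu μ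
  have hexp : ∀ x, HasDerivAt (fun x => Real.exp (μ * x)) (Real.exp (μ * x) * μ) x := fun x => by
    simpa using ((hasDerivAt_id x).const_mul μ).exp
  have h := integral_Ioi_of_hasDerivAt_of_tendsto' (a := 0)
    (f := fun x => u x * u x * Real.exp (μ * x))
    (f' := fun x => 2 * (u x * w x * Real.exp (μ * x)) + μ * (u x * u x * Real.exp (μ * x)))
    (fun x _ => (((hd x).mul (hd x)).mul (hexp x)).congr_deriv (by simp; ring))
    (((integrableOn_mul_weight hu hw hμ).const_mul 2).add
      ((integrableOn_mul_weight hu hu hμ).const_mul μ))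
    (tendsto_zero_of_exp_bound (sub_pos.2 hμ) hC)
  rw [integral_add ((integrableOn_mul_weight hu hw hμ).const_mul 2)
    ((integrableOn_mul_weight hu hu hμ).const_mul μ), integral_const_mul, integral_const_mul] at h
  rw [weightedSq, h]
  simp
  ring

/-- Young's inequality, weighted so that half of a term `ν‖u‖²` absorbs the `u` part. -/
theorem two_mul_integral_le {f u : ℝ → ℝ} (hf : f ∈ expDecay) (hu : u ∈ expDecay) {μ : ℝ}
    (hμ : μ < 1) {ν : ℝ} (hν : 0 < ν) :
    2 * (∫ x in Ioi (0 : ℝ), u x * f x * Real.exp (μ * x)) ≤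
      2 / ν * weightedSq μ f + ν / 2 * weightedSq μ u := by
  rw [weightedSq, weightedSq, ← integral_const_mul, ← integral_const_mul, ← integral_const_mul,
    ← integral_add ((integrableOn_mul_weight hf hf hμ).const_mul _)
      ((integrableOn_mul_weight hu hu hμ).const_mul _)]
  refine integral_mono ((integrableOn_mul_weight hu hf hμ).const_mul _)
    (((integrableOn_mul_weight hf hf hμ).const_mul _).add
      ((integrableOn_mul_weight hu hu hμ).const_mul _)) fun x => ?_
  have e : 2 / ν * (f x * f x) + ν / 2 * (u x * u x) - 2 * (u x * f x) =
      (2 * f x - ν * u x) ^ 2 / (2 * ν) := by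
    field_simp; ring
  have h : 0 ≤ 2 / ν * (f x * f x) + ν / 2 * (u x * u x) - 2 * (u x * f x) := by
    rw [e]; positivity
  have := mul_nonneg h (Real.exp_pos (μ * x)).le
  simp only
  linarith

/-- For `u = Jf` the energy identity gives `μ‖u‖² ≤ 2⟨u, f⟩`, since the boundary term has a
favourable sign. -/
theorem weightedSq_tailPrimitive_le {f : ℝ → ℝ} (hf : f ∈ expDecay) {μ : ℝ} (hμ₀ : 0 < μ)
    (hμ : μ < 1) : weightedSq μ (tailPrimitive f) ≤ (2 / μ) ^ 2 * weightedSq μ f := by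
  have hJ := tailPrimitive_mem hf
  have h1 := energy_identity hJ (expDecay.smul_mem (-1) hf)
    (fun x => (hasDerivAt_tailPrimitive hf x).congr_deriv (by simp)) hμ
  have h2 := two_mul_integral_le hf hJ hμ hμ₀
  have e : ∀ x, tailPrimitive f x * ((-1 : ℝ) • f) x * Real.exp (μ * x) =
      -(tailPrimitive f x * f x * Real.exp (μ * x)) := fun x => by simp
  simp only [e, integral_neg] at h1
  have h3 : μ / 2 * weightedSq μ (tailPrimitive f) ≤ 2 / μ * weightedSq μ f := by
    nlinarith [sq_nonneg (tailPrimitive f 0)]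
  calc _ = 2 / μ * (μ / 2 * weightedSq μ (tailPrimitive f)) := by field_simp
    _ ≤ 2 / μ * (2 / μ * weightedSq μ f) := mul_le_mul_of_nonneg_left h3 (by positivity)
    _ = _ := by ring

/-- For `u = Vf` one has `u' = f - u` and `u(0) = 0`, so the energy identity reads `(2 - μ)‖u‖² =
2⟨u, f⟩`. -/
theorem weightedSq_expConv_le {f : ℝ → ℝ} (hf : f ∈ expDecay) {μ : ℝ} (hμ : μ < 1) :
    weightedSq μ (expConv f) ≤ (2 / (2 - μ)) ^ 2 * weightedSq μ f := by
  have hV := expConv_mem hf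
  have hν : 0 < 2 - μ := by linarith
  have h1 := energy_identity hV (expDecay.sub_mem hf hV) (hasDerivAt_expConv hf.1) hμ
  have h2 := two_mul_integral_le hf hV hμ hν
  have e : ∀ x, expConv f x * (f - expConv f) x * Real.exp (μ * x) =
      expConv f x * f x * Real.exp (μ * x) - expConv f x * expConv f x * Real.exp (μ * x) :=
    fun x => by simp; ring
  simp only [e] at h1
  rw [integral_sub (integrableOn_mul_weight hV hf hμ) (integrableOn_mul_weight hV hV hμ),
    ← weightedSq, expConv_zero_right] at h1
  have h3 : (2 - μ) / 2 * weightedSq μ (expConv f) ≤ 2 / (2 - μ) * weightedSq μ f := by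
    linarith
  calc _ = 2 / (2 - μ) * ((2 - μ) / 2 * weightedSq μ (expConv f)) := by field_simp
    _ ≤ 2 / (2 - μ) * (2 / (2 - μ) * weightedSq μ f) :=
        mul_le_mul_of_nonneg_left h3 (by positivity)
    _ = _ := by ring

/-- Change variables and use `e^{μx} ≤ e^{μcx}`. With `c = e^t`, the Jacobian `c⁻¹` is the source of
the decay rate `1/2`. -/
theorem weightedSq_dilation_le {f : ℝ → ℝ} (hf : f ∈ expDecay) {μ : ℝ} (hμ₀ : 0 < μ)
    (hμ : μ < 1) {c : ℝ} (hc : 1 ≤ c) :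
    weightedSq μ (fun x => f (c * x)) ≤ c⁻¹ * weightedSq μ f := by
  have hc0 : 0 < c := by positivity
  have h := integral_comp_mul_left_Ioi (fun x => f x * f x * Real.exp (μ * x)) 0 hc0
  rw [mul_zero, smul_eq_mul] at h
  rw [weightedSq, weightedSq, ← h]
  have hfc := comp_mul_left hf hc
  have hi := (integrableOn_Ioi_comp_mul_left_iff (fun x => f x * f x * Real.exp (μ * x)) 0 hc0).2
    (by simpa using integrableOn_mul_weight hf hf hμ)
  refine setIntegral_mono_on (integrableOn_mul_weight hfc hfc hμ) hi measurableSet_Ioi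
    fun x hx => ?_
  refine mul_le_mul_of_nonneg_left ?_ (mul_self_nonneg _)
  rw [Real.exp_le_exp]
  have := mul_pos hμ₀ (mem_Ioi.1 hx)
  nlinarith

end expDecay

/-! ### Integrals against the exponential measure -/

theorem measurable_expWeight (μ : ℝ) :
    Measurable fun x : ℝ => ENNReal.ofReal (Real.exp (μ * x)) := by fun_prop

theorem integral_expMeasure (μ : ℝ) (g : ℝ → ℝ) :
    ∫ x, g x ∂expMeasure μ = ∫ x in Ioi 0, g x * Real.exp (μ * x) := by
  rw [expMeasure, integral_withDensity_eq_integral_toReal_smul (measurable_expWeight μ) (by simp)]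
  congr 1
  funext x
  rw [ENNReal.toReal_ofReal (Real.exp_pos _).le, smul_eq_mul, mul_comm]

theorem integrable_expMeasure_iff (μ : ℝ) (g : ℝ → ℝ) :
    Integrable g (expMeasure μ) ↔ IntegrableOn (fun x => g x * Real.exp (μ * x)) (Ioi 0) := by
  rw [expMeasure, integrable_withDensity_iff (measurable_expWeight μ) (by simp), IntegrableOn]
  simp only [ENNReal.toReal_ofReal (Real.exp_pos _).le]

theorem ae_expMeasure_iff (μ : ℝ) {p : ℝ → Prop} :
    (∀ᵐ x ∂expMeasure μ, p x) ↔ ∀ᵐ x ∂volume.restrict (Ioi 0), p x := by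
  constructor
  · intro h
    exact (withDensity_absolutelyContinuous' (measurable_expWeight μ).aemeasurable
      (Eventually.of_forall fun x => by simp [Real.exp_pos])).ae_le h
  · intro h
    exact (withDensity_absolutelyContinuous _ _).ae_le h

theorem memLp_expMeasure_of_exp_bound {μ b C : ℝ} (hb : μ < 2 * b) {g : ℝ → ℝ}
    (hg : Continuous g) (hC : ∀ x, 0 ≤ x → |g x| ≤ C * Real.exp (-b * x)) :
    MemLp g 2 (expMeasure μ) := by
  rw [memLp_two_iff_integrable_sq hg.aestronglyMeasurable, integrable_expMeasure_iff]
  refine integrableOn_Ioi_of_exp_bound ((hg.pow 2).mul (by fun_prop)) (sub_pos.2 hb) (C := C ^ 2)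
    fun x hx => ?_
  have e : Real.exp (-(2 * b - μ) * x) = Real.exp (-b * x) ^ 2 * Real.exp (μ * x) := by
    rw [sq, ← Real.exp_add, ← Real.exp_add]
    ring_nf
  rw [e, ← mul_assoc, ← mul_pow, abs_mul, abs_of_pos (Real.exp_pos _), abs_pow]
  exact mul_le_mul_of_nonneg_right (pow_le_pow_left₀ (abs_nonneg _) (hC x hx) 2)
    (Real.exp_pos _).le

theorem inner_toLp_expMeasure {μ : ℝ} {g : ℝ → ℝ} (hg : MemLp g 2 (expMeasure μ)) (h : L2Exp μ) :
    inner ℝ (hg.toLp g) h = ∫ x in Ioi 0, h x * g x * Real.exp (μ * x) := by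
  rw [L2.inner_def, ← integral_expMeasure μ (fun x => h x * g x)]
  refine integral_congr_ae ?_
  filter_upwards [hg.coeFn_toLp] with x hx
  simp [hx]

/-- The functional `h ↦ ∫ w h` on `L²(e^{μx})`, for a weight with `w e^{-μx} ∈ L²(e^{μx})`. -/
theorem inner_toLp_mul_exp {μ : ℝ} {w : ℝ → ℝ}
    (hw : MemLp (fun x => w x * Real.exp (-μ * x)) 2 (expMeasure μ)) (h : L2Exp μ) :
    inner ℝ (hw.toLp _) h = ∫ x in Ioi 0, w x * h x := by
  rw [inner_toLp_expMeasure]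
  congr 1
  funext x
  have : Real.exp (-μ * x) * Real.exp (μ * x) = 1 := by rw [← Real.exp_add]; simp
  linear_combination h x * w x * this

theorem memLp_one_mul_exp {μ : ℝ} (hμ₀ : 0 < μ) :
    MemLp (fun x => 1 * Real.exp (-μ * x)) 2 (expMeasure μ) :=
  memLp_expMeasure_of_exp_bound (b := μ) (C := 1) (by linarith) (by fun_prop) fun x _ => by
    simp [abs_of_pos (Real.exp_pos _)]

theorem memLp_id_mul_exp {μ : ℝ} (hμ₀ : 0 < μ) :
    MemLp (fun x => x * Real.exp (-μ * x)) 2 (expMeasure μ) :=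
  -- A quarter of the exponential is spent on absorbing the factor `x`; the rest suffices because `μ
  -- < 2 · (3/4)μ`.
  memLp_expMeasure_of_exp_bound (b := 3 / 4 * μ) (C := 4 / μ) (by linarith) (by fun_prop)
    fun x hx => by
      rw [abs_mul, abs_of_nonneg hx, abs_of_pos (Real.exp_pos _)]
      have e : Real.exp (-(3 / 4 * μ) * x) = Real.exp (μ / 4 * x) * Real.exp (-μ * x) := by
        rw [← Real.exp_add]; ring_nf
      rw [e, ← mul_assoc]
      refine mul_le_mul_of_nonneg_right ?_ (Real.exp_pos _).le
      have h1 : μ / 4 * x ≤ Real.exp (μ / 4 * x) := by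
        linarith [Real.add_one_le_exp (μ / 4 * x)]
      calc x = 4 / μ * (μ / 4 * x) := by field_simp
        _ ≤ _ := mul_le_mul_of_nonneg_left h1 (by positivity)

/-- The functional `h ↦ ∫ h` on `L²(e^{μx})`. -/
noncomputable def integralFunctional {μ : ℝ} (hμ₀ : 0 < μ) : L2Exp μ →L[ℝ] ℝ :=
  innerSL ℝ ((memLp_one_mul_exp hμ₀).toLp _)

/-- The functional `h ↦ ∫ x h(x) dx` on `L²(e^{μx})`. -/
noncomputable def momentFunctional {μ : ℝ} (hμ₀ : 0 < μ) : L2Exp μ →L[ℝ] ℝ :=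
  innerSL ℝ ((memLp_id_mul_exp hμ₀).toLp _)

theorem integralFunctional_apply {μ : ℝ} (hμ₀ : 0 < μ) (h : L2Exp μ) :
    integralFunctional hμ₀ h = ∫ x in Ioi 0, h x := by
  refine (inner_toLp_mul_exp (memLp_one_mul_exp hμ₀) h).trans ?_
  simp only [one_mul]

theorem momentFunctional_apply {μ : ℝ} (hμ₀ : 0 < μ) (h : L2Exp μ) :
    momentFunctional hμ₀ h = ∫ x in Ioi 0, x * h x :=
  inner_toLp_mul_exp (memLp_id_mul_exp hμ₀) h

/-- Elements of `L²(e^{μx})` are integrable. -/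
theorem integrableOn_coe_L2Exp {μ : ℝ} (hμ₀ : 0 < μ) (h : L2Exp μ) :
    IntegrableOn h (Ioi 0) := by
  have h1 := (memLp_one_mul_exp hμ₀).integrable_mul (Lp.memLp h)
  refine ((integrable_expMeasure_iff μ _).1 h1).congr (Eventually.of_forall fun x => ?_)
  have : Real.exp (-μ * x) * Real.exp (μ * x) = 1 := by rw [← Real.exp_add]; simp
  simp only [Pi.mul_apply]
  linear_combination h x * this

/-- Test functions are dense in `L²(e^{μx})`. -/
theorem denseRange_testToL2 {μ : ℝ} (hμ₀ : 0 < μ) (hμ : μ < 2) :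
    Dense (LinearMap.range (testToL2 μ hμ) : Set (L2Exp μ)) := by
  rw [Submodule.dense_iff_topologicalClosure_eq_top, Submodule.topologicalClosure_eq_top_iff,
    Submodule.eq_bot_iff]
  intro g hg
  have hint : ∀ φ : 𝓓(halfLine, ℝ), ∫ x in Ioi 0, g x * φ x * Real.exp (μ * x) = 0 := fun φ => by
    rw [← inner_toLp_expMeasure (memLp_testFunction hμ φ)]
    exact (Submodule.mem_orthogonal _ _).1 hg _ ⟨φ, rfl⟩
  have h0 := isOpen_Ioi.ae_eq_zero_of_integral_contDiff_smul_eq_zero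
    (integrableOn_coe_L2Exp hμ₀ g).locallyIntegrableOn fun ψ hψ hc hs => by
      -- The factor `e^{-μx}` cancels the weight, so orthogonality to test functions becomes the
      -- unweighted vanishing criterion.
      let φ : 𝓓(halfLine, ℝ) :=
        { toFun := fun x => ψ x * Real.exp (-μ * x)
          contDiff' := by
            exact hψ.mul (Real.contDiff_exp.comp (contDiff_const.mul contDiff_id))
          hasCompactSupport' := hc.mul_right
          tsupport_subset' := (tsupport_mul_subset_left).trans hs }
      have h1 := hint φ
      rw [← h1, ← setIntegral_eq_integral_of_forall_compl_eq_zero (s := Ioi 0) fun x hx => by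
        rw [image_eq_zero_of_notMem_tsupport fun h => hx (hs h), zero_smul]]
      congr 1
      funext x
      have : Real.exp (-μ * x) * Real.exp (μ * x) = 1 := by rw [← Real.exp_add]; simp
      change ψ x * g x = g x * (ψ x * Real.exp (-μ * x)) * Real.exp (μ * x)
      linear_combination -(g x * ψ x * this)
  refine Lp.ext (EventuallyEq.trans ?_ (Lp.coeFn_zero ℝ 2 (expMeasure μ)).symm)
  refine (ae_expMeasure_iff μ).2 ?_
  exact (ae_restrict_iff' measurableSet_Ioi).2 h0

/-! ### The embedding of exponentially decaying functions -/

theorem memLp_expDecay {μ : ℝ} (hμ₁ : μ < 1) (f : expDecay) : MemLp f.1 2 (expMeasure μ) :=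
  let ⟨_, hC⟩ := f.2.2
  memLp_expMeasure_of_exp_bound (by linarith) f.2.1 hC

/-- The inclusion of the exponentially decaying functions into `L²(e^{μx})`. -/
noncomputable def expDecayToL2 {μ : ℝ} (hμ₁ : μ < 1) : expDecay →ₗ[ℝ] L2Exp μ where
  toFun f := (memLp_expDecay hμ₁ f).toLp f.1
  map_add' f g := MemLp.toLp_add (memLp_expDecay hμ₁ f) (memLp_expDecay hμ₁ g)
  map_smul' c f := MemLp.toLp_const_smul c (memLp_expDecay hμ₁ f)

theorem coeFn_expDecayToL2 {μ : ℝ} (hμ₁ : μ < 1) (f : expDecay) :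
    expDecayToL2 hμ₁ f =ᵐ[expMeasure μ] f.1 :=
  (memLp_expDecay hμ₁ f).coeFn_toLp

theorem norm_expDecayToL2_sq {μ : ℝ} (hμ₁ : μ < 1) (f : expDecay) :
    ‖expDecayToL2 hμ₁ f‖ ^ 2 = expDecay.weightedSq μ f.1 := by
  rw [← real_inner_self_eq_norm_sq]
  refine (inner_toLp_expMeasure (memLp_expDecay hμ₁ f) _).trans ?_
  rw [← integral_expMeasure μ fun x => expDecayToL2 hμ₁ f x * f.1 x, expDecay.weightedSq,
    ← integral_expMeasure μ fun x => f.1 x * f.1 x]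
  refine integral_congr_ae ?_
  filter_upwards [coeFn_expDecayToL2 hμ₁ f] with x hx
  rw [hx]

theorem norm_expDecayToL2_le {μ : ℝ} (hμ₁ : μ < 1) {f g : expDecay} {C : ℝ} (hC : 0 ≤ C)
    (h : expDecay.weightedSq μ f.1 ≤ C ^ 2 * expDecay.weightedSq μ g.1) :
    ‖expDecayToL2 hμ₁ f‖ ≤ C * ‖expDecayToL2 hμ₁ g‖ := by
  rw [← norm_expDecayToL2_sq hμ₁, ← norm_expDecayToL2_sq hμ₁, ← mul_pow] at h
  exact (pow_le_pow_iff_left₀ (norm_nonneg _) (by positivity) two_ne_zero).1 h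

theorem expDecayToL2_congr {μ : ℝ} (hμ₁ : μ < 1) {f g : expDecay} (h : ∀ x, 0 < x → f.1 x = g.1 x) :
    expDecayToL2 hμ₁ f = expDecayToL2 hμ₁ g := by
  refine MemLp.toLp_congr (memLp_expDecay hμ₁ f) (memLp_expDecay hμ₁ g) ((ae_expMeasure_iff μ).2 ?_)
  filter_upwards [ae_restrict_mem measurableSet_Ioi] with x hx using h x hx

theorem eqOn_zero_of_expDecayToL2_eq_zero {μ : ℝ} (hμ₁ : μ < 1) {f : expDecay}
    (h : expDecayToL2 hμ₁ f = 0) : EqOn f.1 (fun _ => 0) (Ioi 0) := by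
  have h1 : (f.1 : ℝ → ℝ) =ᵐ[expMeasure μ] fun _ => 0 := by
    refine (coeFn_expDecayToL2 hμ₁ f).symm.trans ?_
    rw [h]
    exact Lp.coeFn_zero ℝ 2 (expMeasure μ)
  exact Measure.eqOn_open_of_ae_eq ((ae_expMeasure_iff μ).1 h1) isOpen_Ioi f.2.1.continuousOn
    continuousOn_const

theorem testFunction_mem_expDecay (φ : 𝓓(halfLine, ℝ)) : (φ : ℝ → ℝ) ∈ expDecay := by
  obtain ⟨C, hC⟩ := (φ.continuous.mul (f := φ) (g := fun x => Real.exp (1 / 2 * x))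
    (by fun_prop)).bounded_above_of_compact_support (φ.hasCompactSupport.mul_right)
  refine ⟨φ.continuous, C, fun x _ => ?_⟩
  have h := hC x
  rw [Pi.mul_apply, norm_mul, Real.norm_of_nonneg (Real.exp_pos _).le, Real.norm_eq_abs] at h
  have : Real.exp (1 / 2 * x) * Real.exp (-(1 / 2) * x) = 1 := by rw [← Real.exp_add]; simp
  calc |φ x| = |φ x| * Real.exp (1 / 2 * x) * Real.exp (-(1 / 2) * x) := by
        rw [mul_assoc, this, mul_one]
    _ ≤ _ := mul_le_mul_of_nonneg_right h (Real.exp_pos _).le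

theorem expDecayToL2_testFunction {μ : ℝ} (hμ₁ : μ < 1) (hμ : μ < 2) (φ : 𝓓(halfLine, ℝ)) :
    expDecayToL2 hμ₁ ⟨φ, testFunction_mem_expDecay φ⟩ = testToL2 μ hμ φ := rfl

theorem denseRange_expDecayToL2 {μ : ℝ} (hμ₀ : 0 < μ) (hμ₁ : μ < 1) :
    DenseRange (expDecayToL2 hμ₁) := by
  refine (denseRange_testToL2 hμ₀ (hμ₁.trans one_lt_two)).mono ?_
  rintro _ ⟨φ, rfl⟩
  exact ⟨⟨φ, testFunction_mem_expDecay φ⟩, rfl⟩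

theorem L2Exp.clm_ext {μ : ℝ} (hμ₀ : 0 < μ) (hμ₁ : μ < 1) {F : Type*} [NormedAddCommGroup F]
    [NormedSpace ℝ F] {A B : L2Exp μ →L[ℝ] F}
    (h : ∀ f, A (expDecayToL2 hμ₁ f) = B (expDecayToL2 hμ₁ f)) : A = B :=
  DFunLike.coe_injective <|
    (denseRange_expDecayToL2 hμ₀ hμ₁).equalizer A.continuous B.continuous (funext h)

/-- Dominated convergence in the form needed for orbits. -/
theorem tendsto_expDecayToL2_zero {μ : ℝ} (hμ₁ : μ < 1) {ι : Type*} {l : Filter ι}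
    [l.IsCountablyGenerated] (g : ι → expDecay) {C : ℝ}
    (hbound : ∀ᶠ i in l, ∀ x, 0 ≤ x → |(g i).1 x| ≤ C * Real.exp (-(1 / 2) * x))
    (hlim : ∀ x, 0 < x → Tendsto (fun i => (g i).1 x) l (𝓝 0)) :
    Tendsto (fun i => expDecayToL2 hμ₁ (g i)) l (𝓝 0) := by
  rw [tendsto_zero_iff_norm_tendsto_zero]
  have hsq : Tendsto (fun i => ‖expDecayToL2 hμ₁ (g i)‖ ^ 2) l (𝓝 0) := by
    simp only [norm_expDecayToL2_sq, expDecay.weightedSq]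
    have h := tendsto_integral_filter_of_dominated_convergence (μ := volume.restrict (Ioi 0))
      (l := l) (F := fun i x => (g i).1 x * (g i).1 x * Real.exp (μ * x)) (f := fun _ => 0)
      (fun x => C ^ 2 * Real.exp (-(1 - μ) * x)) ?_ ?_ ?_ ?_
    · simpa using h
    · exact Eventually.of_forall fun i =>
        (((g i).2.1.mul (g i).2.1).mul (by fun_prop)).aestronglyMeasurable
    · filter_upwards [hbound] with i hi
      filter_upwards [ae_restrict_mem measurableSet_Ioi] with x hx
      have hx' := hi x (le_of_lt hx)
      have e : Real.exp (-(1 - μ) * x) =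
          Real.exp (-(1 / 2) * x) * Real.exp (-(1 / 2) * x) * Real.exp (μ * x) := by
        rw [← Real.exp_add, ← Real.exp_add]; ring_nf
      rw [e, norm_mul, norm_mul, Real.norm_of_nonneg (Real.exp_pos _).le, Real.norm_eq_abs]
      calc _ ≤ (C * Real.exp (-(1 / 2) * x)) * (C * Real.exp (-(1 / 2) * x)) *
            Real.exp (μ * x) :=
          mul_le_mul_of_nonneg_right (mul_self_le_mul_self (abs_nonneg _) hx')
            (Real.exp_pos _).le
        _ = _ := by ring
    · exact (integrableOn_exp_mul_Ioi (by linarith) 0).const_mul _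
    · filter_upwards [ae_restrict_mem measurableSet_Ioi] with x hx
      simpa using ((hlim x hx).mul (hlim x hx)).mul_const (Real.exp (μ * x))
  simpa using hsq.sqrt

/-! ### The bounded operators -/

namespace expDecay

/-- The tail primitive as a linear map. -/
noncomputable def tailMap : expDecay →ₗ[ℝ] expDecay where
  toFun f := ⟨tailPrimitive f, tailPrimitive_mem f.2⟩
  map_add' f g := Subtype.ext <| funext fun x =>
    integral_add (integrableOn_Ioi f.2 x) (integrableOn_Ioi g.2 x)
  map_smul' c _ := Subtype.ext <| funext fun _ => integral_const_mul c _

/-- The convolution with the exponential as a linear map. -/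
noncomputable def convMap : expDecay →ₗ[ℝ] expDecay where
  toFun f := ⟨expConv f, expConv_mem f.2⟩
  map_add' f g := Subtype.ext <| expConv_add f.2.1 g.2.1
  map_smul' c f := Subtype.ext <| expConv_smul c f

/-- The dilation `f ↦ f(e^t ·)` as a linear map. -/
noncomputable def dilMap (t : ℝ≥0) : expDecay →ₗ[ℝ] expDecay where
  toFun f := ⟨fun x => f.1 (Real.exp t * x), comp_mul_left f.2 (Real.one_le_exp t.2)⟩
  map_add' _ _ := rfl
  map_smul' _ _ := rfl

/-- The function `e^{-x}`. -/
noncomputable def expNeg : expDecay :=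
  ⟨fun x => Real.exp (-x), by fun_prop, 1, fun x hx => by
    rw [abs_of_pos (Real.exp_pos _), one_mul, Real.exp_le_exp]; linarith⟩

end expDecay

section Operators

variable {μ : ℝ}

/-- The tail primitive on `L²(e^{μx})`. -/
noncomputable def tailOp (hμ₁ : μ < 1) : L2Exp μ →L[ℝ] L2Exp μ :=
  ((expDecayToL2 hμ₁).comp expDecay.tailMap).extendOfNorm (expDecayToL2 hμ₁)

/-- The convolution with `e^{-x}` on `L²(e^{μx})`. -/
noncomputable def convOp (hμ₁ : μ < 1) : L2Exp μ →L[ℝ] L2Exp μ :=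
  ((expDecayToL2 hμ₁).comp expDecay.convMap).extendOfNorm (expDecayToL2 hμ₁)

/-- The dilation by `e^t` on `L²(e^{μx})`. -/
noncomputable def dilOp (hμ₁ : μ < 1) (t : ℝ≥0) : L2Exp μ →L[ℝ] L2Exp μ :=
  ((expDecayToL2 hμ₁).comp (expDecay.dilMap t)).extendOfNorm (expDecayToL2 hμ₁)

theorem tailOp_apply (hμ₀ : 0 < μ) (hμ₁ : μ < 1) (f : expDecay) :
    tailOp hμ₁ (expDecayToL2 hμ₁ f) = expDecayToL2 hμ₁ (expDecay.tailMap f) :=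
  LinearMap.extendOfNorm_eq (denseRange_expDecayToL2 hμ₀ hμ₁) ⟨2 / μ, fun f =>
    norm_expDecayToL2_le (f := expDecay.tailMap f) hμ₁ (by positivity) (expDecay.weightedSq_tailPrimitive_le f.2 hμ₀ hμ₁)⟩ f

theorem convOp_apply (hμ₀ : 0 < μ) (hμ₁ : μ < 1) (f : expDecay) :
    convOp hμ₁ (expDecayToL2 hμ₁ f) = expDecayToL2 hμ₁ (expDecay.convMap f) :=
  LinearMap.extendOfNorm_eq (denseRange_expDecayToL2 hμ₀ hμ₁) ⟨2 / (2 - μ), fun f =>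
    norm_expDecayToL2_le (f := expDecay.convMap f) hμ₁ (div_nonneg zero_le_two (by linarith))
      (expDecay.weightedSq_expConv_le f.2 hμ₁)⟩ f

theorem norm_dilMap_le (hμ₀ : 0 < μ) (hμ₁ : μ < 1) (t : ℝ≥0) (f : expDecay) :
    ‖expDecayToL2 hμ₁ (expDecay.dilMap t f)‖ ≤ Real.exp (-(1 / 2) * t) * ‖expDecayToL2 hμ₁ f‖ := by
  refine norm_expDecayToL2_le hμ₁ (Real.exp_pos _).le ?_
  have e : Real.exp (-(1 / 2) * t) ^ 2 = (Real.exp t)⁻¹ := by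
    rw [sq, ← Real.exp_add, ← Real.exp_neg]; ring_nf
  rw [e]
  exact expDecay.weightedSq_dilation_le f.2 hμ₀ hμ₁ (Real.one_le_exp t.2)

theorem dilOp_apply (hμ₀ : 0 < μ) (hμ₁ : μ < 1) (t : ℝ≥0) (f : expDecay) :
    dilOp hμ₁ t (expDecayToL2 hμ₁ f) = expDecayToL2 hμ₁ (expDecay.dilMap t f) :=
  LinearMap.extendOfNorm_eq (denseRange_expDecayToL2 hμ₀ hμ₁) ⟨_, norm_dilMap_le hμ₀ hμ₁ t⟩ f

theorem norm_dilOp_apply_le (hμ₀ : 0 < μ) (hμ₁ : μ < 1) (t : ℝ≥0) (h : L2Exp μ) :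
    ‖dilOp hμ₁ t h‖ ≤ Real.exp (-(1 / 2) * t) * ‖h‖ :=
  LinearMap.norm_extendOfNorm_apply_le (denseRange_expDecayToL2 hμ₀ hμ₁) _
    (norm_dilMap_le hμ₀ hμ₁ t) h

theorem norm_dilOp_apply_le_self (hμ₀ : 0 < μ) (hμ₁ : μ < 1) (t : ℝ≥0) (h : L2Exp μ) : ‖dilOp hμ₁ t h‖ ≤ ‖h‖ := by
  refine (norm_dilOp_apply_le hμ₀ hμ₁ t h).trans (mul_le_of_le_one_left (norm_nonneg _) ?_)
  rw [Real.exp_le_one_iff]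
  have := t.2
  nlinarith

/-! #### Commutation relations -/

theorem tailOp_dilOp (hμ₀ : 0 < μ) (hμ₁ : μ < 1) (t : ℝ≥0) (h : L2Exp μ) :
    tailOp hμ₁ (dilOp hμ₁ t h) = Real.exp (-t) • dilOp hμ₁ t (tailOp hμ₁ h) := by
  have : (tailOp hμ₁).comp (dilOp hμ₁ t) = Real.exp (-t) • (dilOp hμ₁ t).comp (tailOp hμ₁) :=
    L2Exp.clm_ext hμ₀ hμ₁ fun f => by
      simp only [ContinuousLinearMap.comp_apply, _root_.smul_apply,
        tailOp_apply hμ₀, dilOp_apply hμ₀]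
      rw [← map_smul (expDecayToL2 hμ₁)]
      refine expDecayToL2_congr hμ₁ fun x _ => ?_
      rw [Real.exp_neg]
      exact expDecay.tailPrimitive_comp_mul_left f.1 (Real.exp_pos t) x
  exact congrArg (fun A : L2Exp μ →L[ℝ] L2Exp μ => A h) this

theorem tailOp_convOp (hμ₀ : 0 < μ) (hμ₁ : μ < 1) (h : L2Exp μ) :
    tailOp hμ₁ (convOp hμ₁ h) = tailOp hμ₁ h + convOp hμ₁ h := by
  have : (tailOp hμ₁).comp (convOp hμ₁) = tailOp hμ₁ + convOp hμ₁ :=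
    L2Exp.clm_ext hμ₀ hμ₁ fun f => by
      simp only [ContinuousLinearMap.comp_apply, _root_.add_apply,
        tailOp_apply hμ₀, convOp_apply hμ₀]
      rw [← map_add]
      exact expDecayToL2_congr hμ₁ fun x _ => expDecay.tailPrimitive_expConv f.2 x
  exact congrArg (fun A : L2Exp μ →L[ℝ] L2Exp μ => A h) this

theorem convOp_dilOp (hμ₀ : 0 < μ) (hμ₁ : μ < 1) (t : ℝ≥0) (h : L2Exp μ) :
    convOp hμ₁ (dilOp hμ₁ t h) = Real.exp (-t) • dilOp hμ₁ t (convOp hμ₁ h) +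
      (1 - Real.exp (-t)) • convOp hμ₁ (dilOp hμ₁ t (convOp hμ₁ h)) := by
  have : (convOp hμ₁).comp (dilOp hμ₁ t) = Real.exp (-t) • (dilOp hμ₁ t).comp (convOp hμ₁) +
      (1 - Real.exp (-t)) • (convOp hμ₁).comp ((dilOp hμ₁ t).comp (convOp hμ₁)) :=
    L2Exp.clm_ext hμ₀ hμ₁ fun f => by
      simp only [ContinuousLinearMap.comp_apply, _root_.smul_apply,
        _root_.add_apply, convOp_apply hμ₀, dilOp_apply hμ₀]
      rw [← map_smul (expDecayToL2 hμ₁), ← map_smul (expDecayToL2 hμ₁), ← map_add]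
      refine expDecayToL2_congr hμ₁ fun x _ => ?_
      rw [Real.exp_neg]
      exact expDecay.expConv_dilation f.2 (Real.one_le_exp t.2) x
  exact congrArg (fun A : L2Exp μ →L[ℝ] L2Exp μ => A h) this

theorem integralFunctional_expDecayToL2 (hμ₀ : 0 < μ) (hμ₁ : μ < 1) (f : expDecay) :
    integralFunctional hμ₀ (expDecayToL2 hμ₁ f) = ∫ x in Ioi 0, f.1 x := by
  rw [integralFunctional_apply]
  exact integral_congr_ae ((ae_expMeasure_iff μ).1 (coeFn_expDecayToL2 hμ₁ f))

theorem momentFunctional_expDecayToL2 (hμ₀ : 0 < μ) (hμ₁ : μ < 1) (f : expDecay) :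
    momentFunctional hμ₀ (expDecayToL2 hμ₁ f) = ∫ x in Ioi 0, x * f.1 x := by
  rw [momentFunctional_apply]
  refine integral_congr_ae ?_
  filter_upwards [(ae_expMeasure_iff μ).1 (coeFn_expDecayToL2 hμ₁ f)] with x hx
  rw [hx]

theorem integralFunctional_dilOp (hμ₀ : 0 < μ) (hμ₁ : μ < 1) (t : ℝ≥0) (h : L2Exp μ) :
    integralFunctional hμ₀ (dilOp hμ₁ t h) = Real.exp (-t) * integralFunctional hμ₀ h := by
  have : (integralFunctional hμ₀).comp (dilOp hμ₁ t) = Real.exp (-t) • integralFunctional hμ₀ :=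
    L2Exp.clm_ext hμ₀ hμ₁ fun f => by
      simp only [ContinuousLinearMap.comp_apply, _root_.smul_apply, dilOp_apply hμ₀,
        integralFunctional_expDecayToL2]
      have := expDecay.tailPrimitive_comp_mul_left f.1 (Real.exp_pos t) 0
      rwa [mul_zero, ← Real.exp_neg] at this
  exact congrArg (fun A : L2Exp μ →L[ℝ] ℝ => A h) this

theorem integralFunctional_tailOp (hμ₀ : 0 < μ) (hμ₁ : μ < 1) (h : L2Exp μ) :
    integralFunctional hμ₀ (tailOp hμ₁ h) = momentFunctional hμ₀ h := by
  have : (integralFunctional hμ₀).comp (tailOp hμ₁) = momentFunctional hμ₀ :=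
    L2Exp.clm_ext hμ₀ hμ₁ fun f => by
      rw [ContinuousLinearMap.comp_apply, tailOp_apply hμ₀, integralFunctional_expDecayToL2,
        momentFunctional_expDecayToL2]
      exact expDecay.integral_tailPrimitive f.2
  exact congrArg (fun A : L2Exp μ →L[ℝ] ℝ => A h) this

theorem convOp_add_tailOp (hμ₀ : 0 < μ) (hμ₁ : μ < 1) (h : L2Exp μ) :
    convOp hμ₁ h + (tailOp hμ₁ h - convOp hμ₁ (tailOp hμ₁ h)) =
      integralFunctional hμ₀ h • expDecayToL2 hμ₁ expDecay.expNeg := by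
  have : convOp hμ₁ + (tailOp hμ₁ - (convOp hμ₁).comp (tailOp hμ₁)) =
      (integralFunctional hμ₀).smulRight (expDecayToL2 hμ₁ expDecay.expNeg) :=
    L2Exp.clm_ext hμ₀ hμ₁ fun f => by
      simp only [ContinuousLinearMap.comp_apply, _root_.add_apply,
        _root_.sub_apply, tailOp_apply hμ₀, convOp_apply hμ₀,
        ContinuousLinearMap.smulRight_apply, integralFunctional_expDecayToL2]
      rw [← map_sub, ← map_add, ← map_smul]
      exact expDecayToL2_congr hμ₁ fun x _ => expDecay.expConv_tailPrimitive f.2 x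
  exact congrArg (fun A : L2Exp μ →L[ℝ] L2Exp μ => A h) this

/-- If `Jf = 0` on the half line, then `f = -(Jf)' = 0` there. -/
theorem expDecayToL2_eq_zero_of_tailOp (hμ₀ : 0 < μ) (hμ₁ : μ < 1) {f : expDecay} (h : tailOp hμ₁ (expDecayToL2 hμ₁ f) = 0) :
    expDecayToL2 hμ₁ f = 0 := by
  rw [tailOp_apply hμ₀] at h
  have h1 := eqOn_zero_of_expDecayToL2_eq_zero hμ₁ h
  rw [← map_zero (expDecayToL2 hμ₁)]
  refine expDecayToL2_congr hμ₁ fun x hx => ?_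
  have h2 : HasDerivAt (tailPrimitive f) 0 x :=
    (hasDerivAt_const x (0 : ℝ)).congr_of_eventuallyEq (h1.eventuallyEq_of_mem (Ioi_mem_nhds hx))
  simpa using (expDecay.hasDerivAt_tailPrimitive f.2 x).unique h2

end Operators

/-! ### The dilation semigroup and its generator. -/

theorem HasDerivAt.tendsto_nnreal_slope {g : ℝ → ℝ} {g' : ℝ} (h : HasDerivAt g g' 0) :
    Tendsto (fun t : ℝ≥0 => (t : ℝ)⁻¹ * (g t - g 0)) (𝓝[>] 0) (𝓝 g') := by
  have hc : Tendsto (fun t : ℝ≥0 => (t : ℝ)) (𝓝[>] 0) (𝓝[≠] 0) := by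
    refine tendsto_nhdsWithin_iff.2 ⟨?_, ?_⟩
    · simpa using (NNReal.continuous_coe.tendsto 0).mono_left nhdsWithin_le_nhds
    · filter_upwards [self_mem_nhdsWithin] with t ht
      simpa using (ne_of_gt ht : t ≠ 0)
  refine ((hasDerivAt_iff_tendsto_slope.1 h).comp hc).congr fun t => ?_
  simp [slope]

section Dilation

variable {μ : ℝ}

theorem expDecay.abs_dilMap_le {f : expDecay} {C : ℝ} (hC0 : 0 ≤ C)
    (hC : ∀ x, 0 ≤ x → |f.1 x| ≤ C * Real.exp (-(1 / 2) * x)) (t : ℝ≥0) {x : ℝ} (hx : 0 ≤ x) :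
    |(expDecay.dilMap t f).1 x| ≤ C * Real.exp (-(1 / 2) * x) := by
  refine (hC _ (by positivity)).trans ?_
  gcongr ?_ * ?_
  rw [Real.exp_le_exp]
  have := mul_le_mul_of_nonneg_right (Real.one_le_exp t.coe_nonneg) hx
  linarith

theorem continuous_dilOp_apply (hμ₀ : 0 < μ) (hμ₁ : μ < 1) (h : L2Exp μ) :
    Continuous fun t => dilOp hμ₁ t h := by
  -- Dilations are contractions, so the orbit of `h` is a uniform limit of orbits of exponentially
  -- decaying functions.
  refine continuous_of_uniform_approx_of_continuous fun u hu => ?_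
  obtain ⟨ε, hε, hεu⟩ := Metric.mem_uniformity_dist.1 hu
  obtain ⟨f, hf⟩ := (denseRange_expDecayToL2 hμ₀ hμ₁).exists_dist_lt h hε
  refine ⟨fun t => dilOp hμ₁ t (expDecayToL2 hμ₁ f), ?_, fun t => hεu ?_⟩
  · simp only [dilOp_apply hμ₀]
    obtain ⟨C, hC0, hC⟩ := expDecay.exists_bound f.2
    refine continuous_iff_continuousAt.2 fun t => ?_
    rw [ContinuousAt, ← tendsto_sub_nhds_zero_iff]
    simp only [← map_sub (expDecayToL2 hμ₁)]
    refine tendsto_expDecayToL2_zero hμ₁ _ (C := 2 * C)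
      (Eventually.of_forall fun s x hx => ?_) fun x _ => ?_
    · have h1 := expDecay.abs_dilMap_le hC0 hC s hx
      have h2 := expDecay.abs_dilMap_le hC0 hC t hx
      refine (abs_sub _ _).trans ?_
      linarith
    · have hc : Continuous fun s : ℝ≥0 => f.1 (Real.exp s * x) - f.1 (Real.exp t * x) :=
        (f.2.1.comp (by fun_prop)).sub continuous_const
      simpa [expDecay.dilMap] using hc.tendsto t
  · rw [dist_eq_norm, ← map_sub]
    exact (norm_dilOp_apply_le_self hμ₀ hμ₁ t _).trans_lt (by rwa [← dist_eq_norm])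

/-- The semigroup of dilations `h ↦ h(e^t ·)` on `L²(e^{μx})`. -/
noncomputable def dilSemigroup (hμ₀ : 0 < μ) (hμ₁ : μ < 1) : C0Semigroup (L2Exp μ) where
  op := dilOp hμ₁
  op_zero := L2Exp.clm_ext hμ₀ hμ₁ fun f => by
    rw [dilOp_apply hμ₀]
    exact expDecayToL2_congr hμ₁ fun x _ => by simp [expDecay.dilMap]
  op_add s t := L2Exp.clm_ext hμ₀ hμ₁ fun f => by
    rw [ContinuousLinearMap.comp_apply, dilOp_apply hμ₀, dilOp_apply hμ₀, dilOp_apply hμ₀]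
    refine expDecayToL2_congr hμ₁ fun x _ => ?_
    simp only [expDecay.dilMap, LinearMap.coe_mk, AddHom.coe_mk, NNReal.coe_add]
    rw [add_comm, Real.exp_add, mul_assoc]
  continuous_orbit := continuous_dilOp_apply hμ₀ hμ₁

theorem dilSemigroup_op (hμ₀ : 0 < μ) (hμ₁ : μ < 1) (t : ℝ≥0) :
    (dilSemigroup hμ₀ hμ₁).op t = dilOp hμ₁ t := rfl

/-- The generator of the dilations is `x d/dx` on nice functions. -/
theorem hasGen_dilSemigroup (hμ₀ : 0 < μ) (hμ₁ : μ < 1) {f g : expDecay} {d : ℝ → ℝ}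
    (hd : ∀ x, HasDerivAt f.1 (d x) x) (hg : ∀ x, g.1 x = x * d x) :
    (dilSemigroup hμ₀ hμ₁).HasGen (expDecayToL2 hμ₁ f) (expDecayToL2 hμ₁ g) := by
  obtain ⟨C, hC0, hC⟩ := expDecay.exists_bound g.2
  have hderiv : ∀ x s : ℝ, HasDerivAt (fun s => f.1 (Real.exp s * x)) (g.1 (Real.exp s * x)) s := by
    intro x s
    refine ((hd (Real.exp s * x)).comp s ((Real.hasDerivAt_exp s).mul_const x)).congr_deriv ?_
    rw [hg]
    ring
  rw [C0Semigroup.HasGen, ← tendsto_sub_nhds_zero_iff]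
  simp only [dilSemigroup_op, dilOp_apply hμ₀, ← map_sub (expDecayToL2 hμ₁),
    ← map_smul (expDecayToL2 hμ₁)]
  refine tendsto_expDecayToL2_zero hμ₁ _ (C := 2 * C) ?_ fun x _ => ?_
  · filter_upwards [self_mem_nhdsWithin] with t ht x hx
    have ht' : (0 : ℝ) < t := ht
    -- The derivative of `s ↦ f(e^s x)` is `g(e^s x)`, bounded by the envelope of `g` for all `s ≥
    -- 0`. Hence the difference quotients are dominated uniformly in `t`; subtracting `g` doubles
    -- the constant.
    have hmv := norm_image_sub_le_of_norm_deriv_le_segment' (a := 0) (b := t)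
      (fun s _ => (hderiv x s).hasDerivWithinAt) (C := C * Real.exp (-(1 / 2) * x))
      (fun s hs => expDecay.abs_dilMap_le hC0 hC ⟨s, hs.1⟩ hx) t ⟨ht'.le, le_rfl⟩
    rw [sub_zero, Real.exp_zero, one_mul, Real.norm_eq_abs] at hmv
    have h1 : |(t : ℝ)⁻¹ * (f.1 (Real.exp t * x) - f.1 x)| ≤ C * Real.exp (-(1 / 2) * x) := by
      rw [abs_mul, abs_of_pos (inv_pos.2 ht'), inv_mul_le_iff₀ ht']
      linarith
    refine (abs_sub _ _).trans ?_
    have h2 := hC x hx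
    change |(t : ℝ)⁻¹ * (f.1 (Real.exp t * x) - f.1 x)| + |g.1 x| ≤ _
    linarith
  · have h1 := (HasDerivAt.tendsto_nnreal_slope (hderiv x 0)).sub_const (g.1 x)
    simpa [expDecay.dilMap] using h1

end Dilation

/-! ### The semigroup of the linearised coagulation operator -/

section Coagulation

variable {μ : ℝ}

/-- The operator `1 - V`, where `V` is the convolution with `e^{-x}`. -/
noncomputable def coConvOp (hμ₁ : μ < 1) : L2Exp μ →L[ℝ] L2Exp μ :=
  ContinuousLinearMap.id ℝ (L2Exp μ) - convOp hμ₁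

theorem coConvOp_apply (hμ₁ : μ < 1) (h : L2Exp μ) : coConvOp hμ₁ h = h - convOp hμ₁ h := rfl

/-- The semigroup operator: with `a = e^{-t}`, dilation operator `D`, tail primitive `J` and
convolution `V` it is `D - 2 (1 - a) (1 - V) D J - a⁻¹ (1 - a)² (1 - V) V D J`. -/
noncomputable def coagOp (hμ₁ : μ < 1) (t : ℝ≥0) : L2Exp μ →L[ℝ] L2Exp μ :=
  dilOp hμ₁ t - (1 - Real.exp (-t)) •
    (coConvOp hμ₁).comp (((2 : ℝ) • ContinuousLinearMap.id ℝ (L2Exp μ) +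
      (Real.exp t * (1 - Real.exp (-t))) • convOp hμ₁).comp ((dilOp hμ₁ t).comp (tailOp hμ₁)))

theorem coagOp_apply (hμ₁ : μ < 1) (t : ℝ≥0) (h : L2Exp μ) :
    coagOp hμ₁ t h = dilOp hμ₁ t h - (1 - Real.exp (-t)) •
      coConvOp hμ₁ ((2 : ℝ) • dilOp hμ₁ t (tailOp hμ₁ h) +
        (Real.exp t * (1 - Real.exp (-t))) • convOp hμ₁ (dilOp hμ₁ t (tailOp hμ₁ h))) := rfl

/-- The operator `a + (1 - a) V`. -/
noncomputable def mixOp (hμ₁ : μ < 1) (a : ℝ) : L2Exp μ →L[ℝ] L2Exp μ :=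
  a • ContinuousLinearMap.id ℝ (L2Exp μ) + (1 - a) • convOp hμ₁

theorem mixOp_apply (hμ₁ : μ < 1) (a : ℝ) (h : L2Exp μ) :
    mixOp hμ₁ a h = a • h + (1 - a) • convOp hμ₁ h := rfl

theorem mixOp_comm (hμ₁ : μ < 1) (a b : ℝ) (h : L2Exp μ) :
    mixOp hμ₁ a (mixOp hμ₁ b h) = mixOp hμ₁ b (mixOp hμ₁ a h) := by
  simp only [mixOp_apply, map_add, map_smul]
  module

/-- On the Laplace side the multipliers telescope: `(1 + as)/(1 + s) · (1 + abs)/(1 + as) = (1 +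
abs)/(1 + s)`. Here this is a consequence of `convOp_dilOp`. -/
theorem mixOp_dilOp_mixOp (hμ₀ : 0 < μ) (hμ₁ : μ < 1) (t : ℝ≥0) (b : ℝ) (h : L2Exp μ) :
    mixOp hμ₁ (Real.exp (-t)) (dilOp hμ₁ t (mixOp hμ₁ b h)) =
      mixOp hμ₁ (Real.exp (-t) * b) (dilOp hμ₁ t h) := by
  simp only [mixOp_apply, map_add, map_smul]
  rw [convOp_dilOp hμ₀ hμ₁ t h]
  module

theorem tailOp_coConvOp (hμ₀ : 0 < μ) (hμ₁ : μ < 1) (h : L2Exp μ) :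
    tailOp hμ₁ (coConvOp hμ₁ h) = -convOp hμ₁ h := by
  rw [coConvOp_apply, map_sub, tailOp_convOp hμ₀]
  abel

/-- The factorisation `a⁻¹ M_a² D_t J` from which the formula for `coagOp` is designed; it follows
from `J D_t = a D_t J` and `J(1 - V) = -V`. -/
theorem tailOp_coagOp (hμ₀ : 0 < μ) (hμ₁ : μ < 1) (t : ℝ≥0) (h : L2Exp μ) :
    tailOp hμ₁ (coagOp hμ₁ t h) = Real.exp t •
      mixOp hμ₁ (Real.exp (-t)) (mixOp hμ₁ (Real.exp (-t)) (dilOp hμ₁ t (tailOp hμ₁ h))) := by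
  have e : Real.exp t * Real.exp (-t) = 1 := by rw [← Real.exp_add]; simp
  simp only [coagOp_apply, mixOp_apply, map_sub, map_add, map_smul, tailOp_dilOp hμ₀,
    tailOp_coConvOp hμ₀]
  match_scalars
  · linear_combination (-Real.exp (-t)) * e
  · linear_combination (-2 * (1 - Real.exp (-t))) * e
  · ring

/-- Keeps the orbits in the class on which `J` is known to be injective. -/
theorem exists_coagOp_expDecayToL2 (hμ₀ : 0 < μ) (hμ₁ : μ < 1) (t : ℝ≥0) (f : expDecay) :
    ∃ g, coagOp hμ₁ t (expDecayToL2 hμ₁ f) = expDecayToL2 hμ₁ g := by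
  simp only [coagOp_apply, coConvOp_apply, dilOp_apply hμ₀, convOp_apply hμ₀, tailOp_apply hμ₀,
    ← map_sub (expDecayToL2 hμ₁), ← map_add (expDecayToL2 hμ₁), ← map_smul (expDecayToL2 hμ₁)]
  exact ⟨_, rfl⟩

/-- Both sides are compared after applying `J`. There `M_a² D_s M_b² D_t` collapses to `M_{ab}²
D_{s+t}` by using `mixOp_dilOp_mixOp` twice, the factors `M` commuting. -/
theorem coagOp_add (hμ₀ : 0 < μ) (hμ₁ : μ < 1) (s t : ℝ≥0) :
    coagOp hμ₁ (s + t) = (coagOp hμ₁ s).comp (coagOp hμ₁ t) := by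
  refine L2Exp.clm_ext hμ₀ hμ₁ fun f => ?_
  rw [ContinuousLinearMap.comp_apply, ← sub_eq_zero]
  have hJ : tailOp hμ₁ (coagOp hμ₁ (s + t) (expDecayToL2 hμ₁ f) -
      coagOp hμ₁ s (coagOp hμ₁ t (expDecayToL2 hμ₁ f))) = 0 := by
    rw [map_sub, tailOp_coagOp hμ₀, tailOp_coagOp hμ₀, tailOp_coagOp hμ₀, map_smul, map_smul,
      map_smul, smul_smul, mixOp_dilOp_mixOp hμ₀, mixOp_comm hμ₁ (Real.exp (-s)),
      mixOp_dilOp_mixOp hμ₀, ← Real.exp_add, ← Real.exp_add, NNReal.coe_add, neg_add,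
      ← dilSemigroup_op hμ₀ hμ₁, C0Semigroup.op_add_apply, dilSemigroup_op, dilSemigroup_op,
      sub_self]
  obtain ⟨g₁, h₁⟩ := exists_coagOp_expDecayToL2 hμ₀ hμ₁ (s + t) f
  obtain ⟨g₂, h₂⟩ := exists_coagOp_expDecayToL2 hμ₀ hμ₁ t f
  obtain ⟨g₃, h₃⟩ := exists_coagOp_expDecayToL2 hμ₀ hμ₁ s g₂
  rw [h₁, h₂, h₃, ← map_sub] at hJ ⊢
  exact expDecayToL2_eq_zero_of_tailOp hμ₀ hμ₁ hJ

/-- The semigroup generated by the linearised coagulation operator. -/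
noncomputable def coagSemigroup (hμ₀ : 0 < μ) (hμ₁ : μ < 1) : C0Semigroup (L2Exp μ) where
  op := coagOp hμ₁
  op_zero := by
    ext1 h
    have := (dilSemigroup hμ₀ hμ₁).op_zero_apply h
    rw [dilSemigroup_op] at this
    simp [coagOp_apply, this]
  op_add := coagOp_add hμ₀ hμ₁
  continuous_orbit h := by
    have h1 := continuous_dilOp_apply hμ₀ hμ₁ h
    have h2 := continuous_dilOp_apply hμ₀ hμ₁ (tailOp hμ₁ h)
    simp only [coagOp_apply]
    fun_prop

/-- The bounded part `h ↦ -2 (1 - V) J h` of the linearised coagulation operator. -/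
noncomputable def coagBounded (hμ₁ : μ < 1) : L2Exp μ →L[ℝ] L2Exp μ :=
  (-2 : ℝ) • (coConvOp hμ₁).comp (tailOp hμ₁)

theorem coagBounded_apply (hμ₁ : μ < 1) (h : L2Exp μ) :
    coagBounded hμ₁ h = (-2 : ℝ) • coConvOp hμ₁ (tailOp hμ₁ h) := rfl

/-- The difference quotients of the two semigroups differ by a term that converges for every `x`,
since `(1 - e^{-t})/t → 1` and the remaining factor is continuous in `t`. So one quotient converges
exactly when the other does. -/
theorem hasGen_coagSemigroup_iff (hμ₀ : 0 < μ) (hμ₁ : μ < 1) (x y : L2Exp μ) :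
    (coagSemigroup hμ₀ hμ₁).HasGen x y ↔
      (dilSemigroup hμ₀ hμ₁).HasGen x (y - coagBounded hμ₁ x) := by
  set R : ℝ≥0 → L2Exp μ := fun t => (2 : ℝ) • dilOp hμ₁ t (tailOp hμ₁ x) +
    (Real.exp t * (1 - Real.exp (-t))) • convOp hμ₁ (dilOp hμ₁ t (tailOp hμ₁ x)) with hR
  have hRc : Continuous R := by
    have h2 := continuous_dilOp_apply hμ₀ hμ₁ (tailOp hμ₁ x)
    fun_prop
  have hR0 : R 0 = (2 : ℝ) • tailOp hμ₁ x := by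
    have := (dilSemigroup hμ₀ hμ₁).op_zero_apply (tailOp hμ₁ x)
    rw [dilSemigroup_op] at this
    simp [hR, this]
  have hs : Tendsto (fun t : ℝ≥0 => (t : ℝ)⁻¹ * (1 - Real.exp (-t))) (𝓝[>] 0) (𝓝 1) := by
    have hd : HasDerivAt (fun s : ℝ => 1 - Real.exp (-s)) 1 0 := by
      simpa using ((hasDerivAt_neg (0 : ℝ)).exp).const_sub 1
    simpa using hd.tendsto_nnreal_slope
  have hlim : Tendsto (fun t : ℝ≥0 => ((t : ℝ)⁻¹ * (1 - Real.exp (-t))) • coConvOp hμ₁ (R t))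
      (𝓝[>] 0) (𝓝 (-coagBounded hμ₁ x)) := by
    have h1 := hs.smul
      ((((coConvOp hμ₁).continuous.comp hRc).tendsto 0).mono_left (nhdsWithin_le_nhds (s := Ioi 0)))
    have e : (1 : ℝ) • ((coConvOp hμ₁) ∘ R) 0 = -coagBounded hμ₁ x := by
      rw [Function.comp_apply, hR0, coagBounded_apply, map_smul]
      module
    rwa [e] at h1
  have hsplit : ∀ t : ℝ≥0, (t : ℝ)⁻¹ • ((dilSemigroup hμ₀ hμ₁).op t x - x) =
      (t : ℝ)⁻¹ • ((coagSemigroup hμ₀ hμ₁).op t x - x) +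
        ((t : ℝ)⁻¹ * (1 - Real.exp (-t))) • coConvOp hμ₁ (R t) := fun t => by
    change _ = (t : ℝ)⁻¹ • (coagOp hμ₁ t x - x) + _
    rw [coagOp_apply, dilSemigroup_op]
    module
  constructor
  · intro h
    refine (Tendsto.add h hlim).congr (fun t => (hsplit t).symm) |>.trans ?_
    rw [← sub_eq_add_neg]
  · intro h
    have h1 := (Tendsto.sub h hlim).congr fun t => by
      rw [hsplit t, add_sub_cancel_right]
    rwa [sub_neg_eq_add, sub_add_cancel] at h1

/-- The dilation of a test function. -/
noncomputable def dilTest (t : ℝ) (φ : 𝓓(halfLine, ℝ)) : 𝓓(halfLine, ℝ) where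
  toFun x := φ (Real.exp t * x)
  contDiff' := φ.contDiff.comp (contDiff_const.mul contDiff_id)
  hasCompactSupport' :=
    φ.hasCompactSupport.comp_homeomorph (Homeomorph.mulLeft₀ _ (Real.exp_pos t).ne')
  tsupport_subset' := by
    refine (tsupport_comp_subset_preimage φ (by fun_prop)).trans fun x hx => ?_
    exact (mul_pos_iff_of_pos_left (Real.exp_pos t)).1 (φ.tsupport_subset hx)

/-- The function `x φ'(x)` for a test function `φ`. -/
noncomputable def eulerTest (φ : 𝓓(halfLine, ℝ)) : 𝓓(halfLine, ℝ) where
  toFun x := x * deriv φ x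
  contDiff' := contDiff_id.mul (contDiff_infty_iff_deriv.1 φ.contDiff).2
  hasCompactSupport' := φ.hasCompactSupport.deriv.mul_left
  tsupport_subset' :=
    (tsupport_mul_subset_right.trans tsupport_deriv_subset).trans φ.tsupport_subset

theorem hasGen_of_mem_linCoagOp_graph (hμ₀ : 0 < μ) (hμ₁ : μ < 1) (hμ : μ < 2)
    {p : L2Exp μ × L2Exp μ} (hp : p ∈ (linCoagOp μ hμ).graph) :
    (dilSemigroup hμ₀ hμ₁).HasGen p.1 (p.2 - coagBounded hμ₁ p.1) := by
  obtain ⟨φ, h1, h2⟩ := (mem_linCoagOp_graph_iff μ hμ p.1 p.2).1 hp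
  set f : expDecay := ⟨φ, testFunction_mem_expDecay φ⟩
  set g : expDecay := ⟨eulerTest φ, testFunction_mem_expDecay _⟩ with hg
  have e1 : p.1 = expDecayToL2 hμ₁ f := Lp.ext (h1.trans (coeFn_expDecayToL2 hμ₁ f).symm)
  -- Removing the bounded part from `L₀[φ]` leaves `x φ'`, again a test function.
  have e2 : p.2 - coagBounded hμ₁ p.1 = expDecayToL2 hμ₁ g := by
    rw [sub_eq_iff_eq_add, e1, coagBounded_apply, coConvOp_apply, tailOp_apply hμ₀,
      convOp_apply hμ₀, ← map_sub, ← map_smul, ← map_add]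
    refine Lp.ext (h2.trans (EventuallyEq.trans ?_ (coeFn_expDecayToL2 hμ₁ _).symm))
    refine Eventually.of_forall fun x => ?_
    change x * deriv φ x - 2 * tailPrimitive φ x + 2 * expConv (tailPrimitive φ) x =
      x * deriv φ x + -2 * (tailPrimitive φ x - expConv (tailPrimitive φ) x)
    ring
  rw [e2, e1]
  exact hasGen_dilSemigroup hμ₀ hμ₁ (d := deriv φ)
    (fun x => (φ.contDiff.differentiable (by simp) x).hasDerivAt) fun x => rfl

/-- The core argument is run for the dilations: these preserve test functions, whereas `J` and `V`
destroy compact support in `(0, ∞)`. -/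
theorem generates_linCoagOp (hμ₀ : 0 < μ) (hμ₁ : μ < 1) (hμ : μ < 2) :
    Generates (linCoagOp μ hμ) (coagSemigroup hμ₀ hμ₁) := by
  refine C0Semigroup.generates_of_perturbation (D := dilSemigroup hμ₀ hμ₁)
    (norm_dilOp_apply_le_self hμ₀ hμ₁) (coagBounded hμ₁) (hasGen_coagSemigroup_iff hμ₀ hμ₁) _
    (fun p => hasGen_of_mem_linCoagOp_graph hμ₀ hμ₁ hμ) (denseRange_testToL2 hμ₀ hμ) ?_
  rintro _ ⟨φ, rfl⟩ t
  refine ⟨dilTest t φ, ?_⟩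
  rw [← expDecayToL2_testFunction hμ₁, ← expDecayToL2_testFunction hμ₁, dilSemigroup_op,
    dilOp_apply hμ₀]
  rfl

/-! ### Decay on the zero-moment subspace -/

/-- Since `∫ D_t J h = e^{-t} ∫ x h = 0`, `convOp_add_tailOp` gives `V D_t J h = -(1 - V) J D_t J h
= -e^{-t}(1 - V) D_t J² h`, and `e^{-t}` cancels the growing coefficient. -/
theorem coagOp_apply_of_moment_eq_zero (hμ₀ : 0 < μ) (hμ₁ : μ < 1) (t : ℝ≥0) {h : L2Exp μ}
    (hh : momentFunctional hμ₀ h = 0) :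
    coagOp hμ₁ t h = dilOp hμ₁ t h - (2 * (1 - Real.exp (-t))) •
      coConvOp hμ₁ (dilOp hμ₁ t (tailOp hμ₁ h)) + (1 - Real.exp (-t)) ^ 2 •
      coConvOp hμ₁ (coConvOp hμ₁ (dilOp hμ₁ t (tailOp hμ₁ (tailOp hμ₁ h)))) := by
  have h1 := convOp_add_tailOp hμ₀ hμ₁ (dilOp hμ₁ t (tailOp hμ₁ h))
  rw [integralFunctional_dilOp, integralFunctional_tailOp, hh, mul_zero, zero_smul,
    ← coConvOp_apply, tailOp_dilOp hμ₀, map_smul] at h1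
  have e : Real.exp t * Real.exp (-t) = 1 := by rw [← Real.exp_add]; simp
  rw [coagOp_apply, map_add, map_smul, map_smul, eq_neg_of_add_eq_zero_left h1, map_neg, map_smul]
  match_scalars
  · ring
  · ring
  · linear_combination ((1 - Real.exp (-t)) ^ 2) * e

theorem exists_norm_coagOp_le (hμ₀ : 0 < μ) (hμ₁ : μ < 1) :
    ∃ C : ℝ, 0 < C ∧ ∀ h : L2Exp μ, momentFunctional hμ₀ h = 0 → ∀ t : ℝ≥0,
      ‖coagOp hμ₁ t h‖ ≤ C * Real.exp (-(1 / 2) * t) * ‖h‖ := by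
  set W := ‖coConvOp hμ₁‖
  set J := ‖tailOp hμ₁‖
  -- One summand for each term of the rewritten formula; every term contains exactly one dilation,
  -- which supplies `e^{-t/2}`, and `0 ≤ 1 - e^{-t} ≤ 1`.
  refine ⟨1 + 2 * (W * J) + W * W * (J * J), by positivity, fun h hh t => ?_⟩
  set b := Real.exp (-(1 / 2) * t) with hb
  have hb0 : 0 ≤ b := (Real.exp_pos _).le
  have hW : ∀ v, ‖coConvOp hμ₁ v‖ ≤ W * ‖v‖ := (coConvOp hμ₁).le_opNorm
  have hJ : ∀ v, ‖tailOp hμ₁ v‖ ≤ J * ‖v‖ := (tailOp hμ₁).le_opNorm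
  have hD : ∀ v, ‖dilOp hμ₁ t v‖ ≤ b * ‖v‖ := norm_dilOp_apply_le hμ₀ hμ₁ t
  have ha0 : 0 ≤ 1 - Real.exp (-t) := by
    rw [sub_nonneg, Real.exp_le_one_iff]
    exact neg_nonpos.2 t.2
  have ha1 : 1 - Real.exp (-t) ≤ 1 := by linarith [Real.exp_pos (-t)]
  have h1 : ‖coConvOp hμ₁ (dilOp hμ₁ t (tailOp hμ₁ h))‖ ≤ W * (b * (J * ‖h‖)) := by
    refine (hW _).trans ?_
    gcongr
    refine (hD _).trans ?_
    gcongr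
    exact hJ _
  have h2 : ‖coConvOp hμ₁ (coConvOp hμ₁ (dilOp hμ₁ t (tailOp hμ₁ (tailOp hμ₁ h))))‖ ≤
      W * (W * (b * (J * (J * ‖h‖)))) := by
    refine (hW _).trans ?_
    gcongr
    refine (hW _).trans ?_
    gcongr
    refine (hD _).trans ?_
    gcongr
    refine (hJ _).trans ?_
    gcongr
    exact hJ _
  rw [coagOp_apply_of_moment_eq_zero hμ₀ hμ₁ t hh]
  refine (norm_add_le _ _).trans ((add_le_add_left (norm_sub_le _ _) _).trans ?_)
  rw [norm_smul, norm_smul, Real.norm_of_nonneg (by positivity),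
    Real.norm_of_nonneg (by positivity)]
  have h3 := mul_le_mul (by linarith : 2 * (1 - Real.exp (-t)) ≤ 2) h1 (norm_nonneg _) zero_le_two
  have h4 := mul_le_mul (pow_le_one₀ (n := 2) ha0 ha1) h2 (norm_nonneg _) zero_le_one
  linarith [hD h]

end Coagulation

theorem proposition6p1 (μ : ℝ) (hμ₀ : 0 < μ) (hμ₁ : μ < 1) :
    ∃ T : C0Semigroup (L2Exp μ),
      Generates (linCoagOp μ (hμ₁.trans one_lt_two)) T ∧
      ∀ lam : ℝ, lam ≤ 1 / 2 → ∃ C : ℝ, 0 < C ∧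
        ∀ h₀ : L2Exp μ, ∫ x in Ioi (0 : ℝ), x * h₀ x = 0 →
          ∀ t : ℝ≥0, ‖T.op t h₀‖ ≤ C * Real.exp (-lam * t) * ‖h₀‖ := by
  refine ⟨coagSemigroup hμ₀ hμ₁, generates_linCoagOp hμ₀ hμ₁ _, fun lam hlam => ?_⟩
  obtain ⟨C, hC0, hC⟩ := exists_norm_coagOp_le hμ₀ hμ₁
  refine ⟨C, hC0, fun h₀ hh t => (hC h₀ ((momentFunctional_apply hμ₀ h₀).trans hh) t).trans ?_⟩
  -- The constant for the rate `1/2` serves every `lam ≤ 1/2`, because `t ≥ 0`.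
  gcongr
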